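/- Let $k$ be an algebraically closed field. A variety is a reduced, separated scheme of finite type over $k$ (not necessarily irreducible), identified with its set of closed ($=k$-rational) points; an algebraic semigroup is a variety $S$ with an associative composition law $S\times S\to S$, $(x,y)\mapsto xy$, that is a morphism of varieties. Two-sided ideals are understood to be nonempty. Idempotents of $S$ are ordered by $e\le f \iff e=ef=fe$, and a minimal idempotent is one that is minimal among all idempotents of $S$. For an idempotent $e$ put $$eSe=\{ese : s\in S\},\quad {}_eSe=\{x\in S: xe=x,\ ex=e\},\quad eS_e=\{x\in S: ex=x,\ xe=e\},\quad SeS=\{set: s,t\in S\}.$$ Let $S$ be an algebraic semigroup and $e\in S$ a minimal idempotent. Then $eSe$, ${}_eSe$, $eS_e$ are closed in $S$ (and are regarded as closed subvarieties), $eSe$ is an algebraic group with neutral element $e$ under the law of $S$ (inverses below are taken in this group), and: (i) The map $\rho: S\to S$, $s\mapsto s(ese)^{-1}s$ is a retraction of varieties of $S$ to $SeS$. In particular $SeS$ is a closed two-sided ideal of $S$. (ii) The map $\varphi: {}_eSe\times eSe\times eS_e\to S$, $(x,g,y)\mapsto xgy$ yields an isomorphism of varieties to its image, which is $SeS$. (iii)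 Via this isomorphism, the semigroup law on $SeS$ is identified with the law on ${}_eSe\times eSe\times eS_e$ given by $$(x,g,y)(x',g',y')=(x,\,g\,\pi(y,x')\,g',\,y'),$$ where $\pi: eS_e\times {}_eSe\to eSe$ is the morphism $(y,z)\mapsto yz$. The idempotents of $SeS$ are identified with the triples $(x,\pi(y,x)^{-1},y)$, where $x\in {}_eSe$ and $y\in eS_e$. The set $E(SeS)$ of these idempotents is closed in $S$, and $(x,y)\mapsto x\,\pi(y,x)^{-1}\,y$ is an isomorphism of varieties ${}_eSe\times eS_e\to E(SeS)$. (iv) The semigroup $SeS$ has no proper two-sided ideal. (v) $SeS$ is the smallest two-sided ideal of $S$; in particular, it does not depend on the minimal idempotent $e$. (vi) The minimal idempotents of $S$ are exactly the idempotents of $SeS$. -/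

import Mathlib

open CategoryTheory MonoidalCategory CartesianMonoidalCategory AlgebraicGeometry

universe u

/-! ### Abstract semigroups -/

namespace SemigroupKernel

variable {M : Type*} [Semigroup M]

/-- A (nonempty) two-sided ideal of a semigroup. -/
structure IsTwoSidedIdeal {M : Type*} [Mul M] (I : Set M) : Prop where
  nonempty : I.Nonempty
  mul_mem_left : ∀ x : M, ∀ y ∈ I, x * y ∈ I
  mul_mem_right : ∀ x : M, ∀ y ∈ I, y * x ∈ I

/-- The relation `e ≤ f` on idempotents: `e = e f = f e`. -/
def IdemLE (e f : M) : Prop := e = e * f ∧ e = f * e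

/-- `e` is minimal among all idempotents for the order `IdemLE`. -/
structure IsMinimalIdempotent (e : M) : Prop where
  idem : IsIdempotentElem e
  eq_of_le : ∀ f : M, IsIdempotentElem f → IdemLE f e → f = e

/-- The subset `eSe = {e s e}`. -/
def corner (e : M) : Set M := {x | ∃ s, x = e * s * e}

/-- The subset `ₑSe = {x | x e = x and e x = e}`. -/
def leftFiber (e : M) : Set M := {x | x * e = x ∧ e * x = e}

/-- The subset `eSₑ = {x | e x = x and x e = e}`. -/
def rightFiber (e : M) : Set M := {x | e * x = x ∧ x * e = e}

/-- The subsemigroup `SeS = {s e t}`. -/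
def twoSided (e : M) : Subsemigroup M where
  carrier := {x | ∃ s t, x = s * e * t}
  mul_mem' := by
    rintro _ _ ⟨s, t, rfl⟩ ⟨s', t', rfl⟩
    exact ⟨s, t * s' * e * t', by simp only [mul_assoc]⟩

/-- `h` is an inverse of `g` in the monoid `eSe` with neutral element `e`. -/
structure IsCornerInv (e g h : M) : Prop where
  mem : h ∈ corner e
  mul_eq : g * h = e
  eq_mul : h * g = e

open Classical in
/-- The inverse of `g` in the monoid `eSe` (with the junk value `g` if there is none). -/
noncomputable def cornerInv (e g : M) : M :=
  if h : ∃ h, IsCornerInv e g h then h.choose else g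

end SemigroupKernel

/-! ### Varieties over a field and their rational points -/

/-- A variety over `k`: a reduced, separated scheme of finite type over `k`
(not necessarily irreducible). -/
class IsVariety {k : Type u} [Field k] (X : Over (Spec (CommRingCat.of k))) : Prop where
  isReduced : IsReduced X.left
  isSeparated : IsSeparated X.hom
  locallyOfFiniteType : LocallyOfFiniteType X.hom
  quasiCompact : QuasiCompact X.hom

/-- The `k`-rational points of a scheme `X` over `k`. -/
def Pt {k : Type u} [Field k] (X : Over (Spec (CommRingCat.of k))) : Type u :=
  𝟙_ (Over (Spec (CommRingCat.of k))) ⟶ X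

/-- A semigroup object in a monoidal category: an object with an associative law. -/
class SemigroupObj {C : Type*} [Category C] [MonoidalCategory C] (X : C) where
  mul : X ⊗ X ⟶ X
  assoc : (mul ▷ X) ≫ mul = (α_ X X X).hom ≫ (X ◁ mul) ≫ mul

instance SemigroupObj.ofMonObj {C : Type*} [Category C] [MonoidalCategory C] (X : C) [MonObj X] :
    SemigroupObj X where
  mul := MonObj.mul
  assoc := MonObj.mul_assoc X

namespace Pt

variable {k : Type u} [Field k] {X Y : Over (Spec (CommRingCat.of k))}

/-- The underlying point of the scheme `X` of a rational point. -/
noncomputable def toScheme (p : Pt X) : X.left :=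
  (show Spec (CommRingCat.of k) ⟶ X.left from CommaMorphism.left p) (IsLocalRing.closedPoint k)

/-- The Zariski topology on the set of rational points. -/
noncomputable instance : TopologicalSpace (Pt X) := TopologicalSpace.induced toScheme inferInstance

/-- The image of a rational point under a morphism. -/
noncomputable def map (f : X ⟶ Y) (p : Pt X) : Pt Y := CategoryStruct.comp p f

/-- The rational point `(p, q)` of the product `X × Y`. -/
noncomputable def pair (p : Pt X) (q : Pt Y) : Pt (X ⊗ Y) := lift p q

/-- The semigroup law induced on rational points: `p q = μ(p, q)`. -/
noncomputable instance [SemigroupObj X] : Semigroup (Pt X) where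
  mul p q := map SemigroupObj.mul (pair p q)
  mul_assoc p q r := by
    have key (a b c : 𝟙_ (Over (Spec (CommRingCat.of k))) ⟶ X) :
        lift (lift a b ≫ SemigroupObj.mul) c ≫ SemigroupObj.mul
          = lift a (lift b c ≫ SemigroupObj.mul) ≫ SemigroupObj.mul := by
      have h := congrArg (fun f => lift (lift a b) c ≫ f) (SemigroupObj.assoc (X := X))
      simpa [lift_whiskerRight_assoc, lift_lift_associator_hom_assoc,
        lift_whiskerLeft_assoc] using h
    exact key p q r

end Pt

/-- The closed subvariety of `X` attached to a set `A` of rational points: the closure of `A`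
in `X` with its reduced induced scheme structure. When `A` is Zariski closed in the set of
rational points, its rational points are exactly the elements of `A`. -/
noncomputable def closedSubvariety {k : Type u} [Field k] {X : Over (Spec (CommRingCat.of k))}
    (A : Set (Pt X)) : Over (Spec (CommRingCat.of k)) :=
  Over.mk ((Scheme.IdealSheafData.vanishingIdeal
    (TopologicalSpace.Closeds.closure (Pt.toScheme '' A))).subschemeι ≫ X.hom)

/-- The inclusion of `closedSubvariety A` into `X`. -/
noncomputable def closedSubvariety.incl {k : Type u} [Field k]
    {X : Over (Spec (CommRingCat.of k))} (A : Set (Pt X)) : closedSubvariety A ⟶ X :=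
  Over.homMk (Scheme.IdealSheafData.vanishingIdeal
    (TopologicalSpace.Closeds.closure (Pt.toScheme '' A))).subschemeι

/-- A rational point of `closedSubvariety A`, seen in `X`. -/
noncomputable def Pt.incl {k : Type u} [Field k] {X : Over (Spec (CommRingCat.of k))}
    {A : Set (Pt X)} (p : Pt (closedSubvariety A)) : Pt X :=
  Pt.map (closedSubvariety.incl A) p

/-! ### The closed subvarieties of `S` attached to an idempotent `e` -/

section

variable {k : Type u} [Field k] {S : Over (Spec (CommRingCat.of k))} [SemigroupObj S]

open SemigroupKernel

/-- `eSe` as a closed subvariety. -/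
noncomputable abbrev cornerVar (e : Pt S) : Over (Spec (CommRingCat.of k)) :=
  closedSubvariety (corner e)

/-- `ₑSe` as a closed subvariety. -/
noncomputable abbrev leftVar (e : Pt S) : Over (Spec (CommRingCat.of k)) :=
  closedSubvariety (leftFiber e)

/-- `eSₑ` as a closed subvariety. -/
noncomputable abbrev rightVar (e : Pt S) : Over (Spec (CommRingCat.of k)) :=
  closedSubvariety (rightFiber e)

/-- `SeS` as a closed subvariety. -/
noncomputable abbrev twoSidedVar (e : Pt S) : Over (Spec (CommRingCat.of k)) :=
  closedSubvariety (twoSided e : Set (Pt S))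

/-- The set `E(SeS)` of idempotents of `SeS`. -/
def idempotents (e : Pt S) : Set (Pt S) := {f | f ∈ twoSided e ∧ IsIdempotentElem f}

/-- `E(SeS)` as a closed subvariety. -/
noncomputable abbrev idempotentVar (e : Pt S) : Over (Spec (CommRingCat.of k)) :=
  closedSubvariety (idempotents e)

end

/-! The heart of the matter is that $eSe$ is an algebraic group; the rest is algebra with the map
$\iota : s \mapsto (ese)^{-1}$.

On points: minimality makes $e$ the only idempotent of the monoid $eSe$. For $x \in eSe$, the
closures of the tails of the sequence of powers of $x$ stabilise to a closed set $T$. Chevalley's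
theorem for $(a,b) \mapsto (a,ab)$ on $T \times T$ yields $x^n = x^{n+r} b$ with $r > 0$ and $b$ in
the closure of the powers of $x$ (`exists_powSucc_eq`). Since $b$ commutes with $x$, this produces
an idempotent of $eSe$ that is a multiple of $x$; it equals $e$, so $x$ is invertible.

Inversion is a morphism (`exists_inv_of_isUnit`): the scheme of pairs of mutually inverse elements
projects to $G = eSe$ by a surjective monomorphism. As $G$ is reduced, this has a section near the
generic point of a component; translates of that section cover $G$ and glue.

Now $\iota$ is a morphism $S \to S$. The sets $SeS$, ${}_eSe$, $eS_e$ are the fixed points of the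
idempotent endomorphisms $s\,\iota(s)\,s$, $s\,\iota(s)$, $\iota(s)\,s$, and similarly for $eSe$ and
$E(SeS)$; hence they are closed and are retracts of $S$ (`exists_retraction`). An element $s$ of
$SeS$ is recovered from its components $s\,\iota(s)$, $ese$, $\iota(s)\,s$. All identities are
proved once in an abstract semigroup (`IsCornerInversion`), then applied to rational points and, as
in Yoneda's lemma, to the semigroups of $T$-valued points, where they become identities of
morphisms. -/

namespace SemigroupKernel

/-! ### Algebra of a semigroup with inverses in $eMe$ -/

variable {M : Type*} [Semigroup M]

/-- `e` is an idempotent such that every `e s e` is invertible in `e M e`, with inverse `j s`. -/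
structure IsCornerInversion (e : M) (j : M → M) : Prop where
  idem : e * e = e
  left : ∀ s, e * j s = j s
  right : ∀ s, j s * e = j s
  inv_left : ∀ s, j s * (s * e) = e
  inv_right : ∀ s, e * (s * j s) = e

/-- The retraction of `M` to the set of idempotents of `MeM`. -/
def idemRetract (j : M → M) (s : M) : M :=
  s * (j s * (j (j s * (s * (s * j s))) * (j s * s)))

namespace IsCornerInversion

variable {e : M} {j : M → M} (h : IsCornerInversion e j)
include h

theorem idem_assoc (z : M) : e * (e * z) = e * z := by rw [← mul_assoc, h.idem]

theorem left_assoc (s z : M) : e * (j s * z) = j s * z := by rw [← mul_assoc, h.left]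

theorem right_assoc (s z : M) : j s * (e * z) = j s * z := by rw [← mul_assoc, h.right]

theorem inv_left_assoc (s z : M) : j s * (s * (e * z)) = e * z := by
  rw [← mul_assoc s, ← mul_assoc, h.inv_left]

theorem inv_right_assoc (s z : M) : e * (s * (j s * z)) = e * z := by
  rw [← mul_assoc s, ← mul_assoc, h.inv_right]

theorem inv_mul_inv (s : M) : j s * (s * j s) = j s := by
  have := h.inv_left_assoc s (j s)
  rwa [h.left] at this

theorem inv_mul_inv_assoc (s z : M) : j s * (s * (j s * z)) = j s * z := by
  rw [← mul_assoc s, ← mul_assoc, h.inv_mul_inv]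

/-- A right inverse suffices because `j s` is already a left inverse. The values of `j` computed
below come from this criterion. -/
theorem eq_of_inv {s t : M} (ht : e * t = t) (hst : e * (s * t) = e) : j s = t := by
  have h1 := h.inv_left_assoc s t
  rw [ht] at h1
  rw [← h1, ← h.right_assoc s (s * t), hst, h.right]

theorem corner_iff {x : M} : x ∈ corner e ↔ e * (x * e) = x := by
  refine ⟨?_, fun hx => ⟨x, by rw [mul_assoc, hx]⟩⟩
  rintro ⟨s, rfl⟩
  simp only [mul_assoc, h.idem, h.idem_assoc]

/-- On the fibre $exe = e$, so `j x = e`. The fixed-point form is what `exists_retraction` takes as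
input; the criteria for the other subsets serve the same purpose. -/
theorem leftFiber_iff {x : M} : x ∈ leftFiber e ↔ x * j x = x := by
  constructor
  · rintro ⟨h1, h2⟩
    rw [h.eq_of_inv (t := e) h.idem (by rw [h1, h2]), h1]
  · intro hx
    constructor
    · rw [← hx, mul_assoc, h.right]
    · rw [← hx, h.inv_right]

theorem rightFiber_iff {x : M} : x ∈ rightFiber e ↔ j x * x = x := by
  constructor
  · rintro ⟨h1, h2⟩
    rw [h.eq_of_inv (t := e) h.idem (by rw [h2, h.idem]), h1]
  · intro hx
    constructor
    · rw [← hx, h.left_assoc]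
    · rw [← hx, mul_assoc, h.inv_left]

/-- This is $(gh)^{-1} = h^{-1}g^{-1}$ for $g = ese$ and $h = ete$. -/
theorem inv_mul (s t : M) : j (s * (e * t)) = j t * j s := by
  refine h.eq_of_inv (h.left_assoc _ _) ?_
  simp only [mul_assoc, h.inv_right_assoc, h.left, h.inv_right]

theorem twoSided_iff {x : M} : x ∈ twoSided e ↔ x * (j x * x) = x := by
  constructor
  · rintro ⟨s, t, rfl⟩
    rw [mul_assoc s e t, h.inv_mul]
    simp only [mul_assoc, h.inv_right_assoc, h.inv_left_assoc, h.idem_assoc]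
  · intro hx
    exact ⟨x, j x * x, by rw [mul_assoc, h.left_assoc, hx]⟩

theorem inv_eq_of_mem_corner (x : M) : j (e * (x * e)) = j x := by
  refine h.eq_of_inv (h.left _) ?_
  simp only [mul_assoc, h.left, h.inv_right, h.idem]

theorem leftRetract_inv (s : M) : j (s * j s) = e := by
  refine h.eq_of_inv h.idem ?_
  simp only [mul_assoc, h.right, h.inv_right]

theorem rightRetract_inv (s : M) : j (j s * s) = e := by
  refine h.eq_of_inv h.idem ?_
  simp only [mul_assoc, h.inv_left, h.idem]

theorem leftRetract_idem (s : M) : (s * j s) * j (s * j s) = s * j s := by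
  rw [h.leftRetract_inv, mul_assoc, h.right]

theorem rightRetract_idem (s : M) : j (j s * s) * (j s * s) = j s * s := by
  rw [h.rightRetract_inv, h.left_assoc]

theorem twoSidedRetract_inv (s : M) : j (s * (j s * s)) = j s := by
  refine h.eq_of_inv (h.left _) ?_
  simp only [mul_assoc, h.inv_right_assoc, h.inv_right]

theorem twoSidedRetract_idem (s : M) :
    (s * (j s * s)) * (j (s * (j s * s)) * (s * (j s * s))) = s * (j s * s) := by
  rw [h.twoSidedRetract_inv]
  simp only [mul_assoc, h.inv_mul_inv_assoc]

/-- The inverse of `x g y` for `x ∈ ₑMe`, `g ∈ eMe` and `y ∈ eMₑ`. -/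
theorem inv_triple {x g y : M} (hx : e * x = e) (hg : g * e = g) (hy : y * e = e) :
    j (x * (g * y)) = j g := by
  refine h.eq_of_inv (h.left _) ?_
  rw [← h.left g, ← mul_assoc e, ← mul_assoc e, hx, mul_assoc, mul_assoc, ← mul_assoc y,
    hy, ← mul_assoc g, hg, h.inv_right]

/-- The left component of `x g y`. -/
theorem triple_left {x g y : M} (hx : x ∈ leftFiber e) (hg : g ∈ corner e)
    (hy : y ∈ rightFiber e) : (x * (g * y)) * j (x * (g * y)) = x := by
  rw [h.corner_iff] at hg
  have hg1 : e * g = g := by rw [← hg, h.idem_assoc]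
  have hg2 : g * e = g := by rw [← hg]; simp only [mul_assoc, h.idem]
  rw [h.inv_triple hx.2 hg2 hy.2, ← h.left g]
  have h2 : y * (e * j g) = e * j g := by rw [← mul_assoc, hy.2]
  have h3 : g * (e * j g) = e := by rw [h.left]; nth_rw 1 [← hg1]; rw [mul_assoc, h.inv_right]
  rw [mul_assoc, mul_assoc, h2, h3, hx.1]

/-- The right component of `x g y`. -/
theorem triple_right {x g y : M} (hx : x ∈ leftFiber e) (hg : g ∈ corner e)
    (hy : y ∈ rightFiber e) : j (x * (g * y)) * (x * (g * y)) = y := by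
  rw [h.corner_iff] at hg
  have hg1 : e * g = g := by rw [← hg, h.idem_assoc]
  have hg2 : g * e = g := by rw [← hg]; simp only [mul_assoc, h.idem]
  have h3 : j g * g = e := by
    have := h.inv_left g
    rwa [hg2] at this
  rw [h.inv_triple hx.2 hg2 hy.2, ← h.right_assoc, ← mul_assoc e, hx.2, ← mul_assoc e, hg1,
    ← mul_assoc, h3, hy.1]

/-- The middle component of `x g y`. -/
theorem triple_corner {x g y : M} (hx : x ∈ leftFiber e) (hg : g ∈ corner e)
    (hy : y ∈ rightFiber e) : e * ((x * (g * y)) * e) = g := by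
  rw [h.corner_iff] at hg
  rw [mul_assoc, mul_assoc, hy.2, ← mul_assoc, hx.2, hg]

theorem leftRetract_mem (s : M) : s * j s ∈ leftFiber e := h.leftFiber_iff.2 (h.leftRetract_idem s)

theorem rightRetract_mem (s : M) : j s * s ∈ rightFiber e :=
  h.rightFiber_iff.2 (h.rightRetract_idem s)

theorem inv_mem_corner (s : M) : j s ∈ corner e := ⟨j s, by rw [h.left, h.right]⟩

omit h in
theorem triple_mem {x g y : M} (hx : x ∈ leftFiber e) : x * (g * y) ∈ twoSided e :=
  ⟨x, g * y, by rw [hx.1]⟩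

/-- Together with `triple_left`, `triple_corner` and `triple_right`, this makes the component map a
two-sided inverse of $(x,g,y) \mapsto xgy$. -/
theorem eq_triple {x : M} (hx : x ∈ twoSided e) :
    (x * j x) * ((e * (x * e)) * (j x * x)) = x := by
  rw [h.twoSided_iff] at hx
  simp only [mul_assoc, h.left_assoc, h.right_assoc, hx]

omit h in
theorem triple_mul (x g y x' g' y' : M) :
    (x * (g * y)) * (x' * (g' * y')) = x * ((g * ((y * x') * g')) * y') := by
  simp only [mul_assoc]

/-- The idempotents of `MeM` in terms of triples. -/
theorem triple_idem_iff {x g y : M} (hx : x ∈ leftFiber e) (hg : g ∈ corner e)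
    (hy : y ∈ rightFiber e) : IsIdempotentElem (x * (g * y)) ↔ g = j (y * x) := by
  have hg' := h.corner_iff.1 hg
  have hg1 : e * g = g := by rw [← hg', h.idem_assoc]
  have hg2 : g * e = g := by rw [← hg']; simp only [mul_assoc, h.idem]
  have hyx : (y * x) * e = y * x := by rw [mul_assoc, hx.1]
  have hyx' : e * (y * x) = y * x := by rw [← mul_assoc, hy.1]
  constructor
  · intro H
    -- Applying $z \mapsto eze$ to the idempotency relation extracts middle components; cancelling
    -- $g$ in the group $eMe$ then leaves $(yx)g = e$.
    have H2 : g * ((y * x) * g) = g := by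
      have := congrArg (fun z => e * (z * e)) H.eq
      simp only [triple_mul] at this
      rw [h.triple_corner hx hg hy, h.triple_corner hx ?_ hy] at this
      · exact this
      · rw [h.corner_iff, mul_assoc, mul_assoc, hg2, ← mul_assoc, hg1]
    symm
    refine h.eq_of_inv hg1 ?_
    have h3 : ∀ z, e * z = z → j g * (g * z) = z := fun z hz => by
      rw [← hz, h.inv_left_assoc]
    have h4 : (y * x) * g = e := by
      rw [← h3 ((y * x) * g) (by rw [← mul_assoc, hyx']), H2]
      simpa only [hg2] using h.inv_left g
    rw [h4, h.idem]
  · rintro rfl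
    have h3 : j (y * x) * ((y * x) * j (y * x)) = j (y * x) := h.inv_mul_inv _
    rw [IsIdempotentElem, triple_mul, h3]

/-- `idemRetract` keeps the outer components of $x$ and replaces the middle one by the only value
that makes the product idempotent. -/
theorem idempotent_iff {x : M} :
    (x ∈ twoSided e ∧ IsIdempotentElem x) ↔ idemRetract j x = x := by
  have hc : j (j x * x * (x * j x)) ∈ corner e := h.inv_mem_corner _
  have hassoc : j x * (x * (x * j x)) = (j x * x) * (x * j x) := by simp only [mul_assoc]
  have hr : idemRetract j x = (x * j x) * (j ((j x * x) * (x * j x)) * (j x * x)) := by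
    rw [idemRetract, hassoc, mul_assoc x]
  rw [hr]
  constructor
  · rintro ⟨hx, hx'⟩
    have h1 := h.eq_triple hx
    rw [← h1] at hx'
    rw [h.triple_idem_iff (h.leftRetract_mem x) ⟨x, (mul_assoc _ _ _).symm⟩
      (h.rightRetract_mem x)] at hx'
    rw [← hx', h1]
  · intro hx
    refine ⟨hx ▸ triple_mem (h.leftRetract_mem x), ?_⟩
    rw [← hx, h.triple_idem_iff (h.leftRetract_mem x) hc (h.rightRetract_mem x)]

theorem idemRetract_mem {x y : M} (hx : x ∈ leftFiber e) (hy : y ∈ rightFiber e) :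
    x * (j (y * x) * y) ∈ twoSided e ∧ IsIdempotentElem (x * (j (y * x) * y)) :=
  ⟨triple_mem hx, (h.triple_idem_iff hx (h.inv_mem_corner _) hy).2 rfl⟩

theorem idemRetract_idem (s : M) : idemRetract j (idemRetract j s) = idemRetract j s := by
  rw [← h.idempotent_iff, idemRetract]
  have hassoc : j s * (s * (s * j s)) = (j s * s) * (s * j s) := by simp only [mul_assoc]
  rw [hassoc, ← mul_assoc s]
  exact h.idemRetract_mem (h.leftRetract_mem s) (h.rightRetract_mem s)

theorem isTwoSidedIdeal : IsTwoSidedIdeal (twoSided e : Set M) where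
  nonempty := ⟨e, e, e, by rw [h.idem, h.idem]⟩
  mul_mem_left := by
    rintro x _ ⟨s, t, rfl⟩
    exact ⟨x * s, t, by simp only [mul_assoc]⟩
  mul_mem_right := by
    rintro x _ ⟨s, t, rfl⟩
    exact ⟨s, t * x, by simp only [mul_assoc]⟩

/-- If $y$ lies in an ideal, so does $e = j(y)\,y\,e$, and with it all of $MeM$. -/
theorem isLeast : IsLeast {I : Set M | IsTwoSidedIdeal I} (twoSided e : Set M) := by
  refine ⟨h.isTwoSidedIdeal, ?_⟩
  rintro I hI _ ⟨s, t, rfl⟩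
  obtain ⟨y, hy⟩ := hI.nonempty
  refine hI.mul_mem_right _ _ (hI.mul_mem_left _ _ ?_)
  rw [← h.inv_left y]
  exact hI.mul_mem_left _ _ (hI.mul_mem_right _ _ hy)

theorem ideal_eq_univ (I : Set (twoSided e)) (hI : IsTwoSidedIdeal I) : I = Set.univ := by
  obtain ⟨y, hy⟩ := hI.nonempty
  have hmem : ∀ s t : M, (s * e * t) ∈ twoSided e := fun s t => ⟨s, t, rfl⟩
  -- Again $e = j(y)\,y\,e$, but now the multipliers must themselves lie in $MeM$, as `j y` and `e`
  -- do.
  have he : (⟨e, e, e, by rw [h.idem, h.idem]⟩ : twoSided e) ∈ I := by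
    have := hI.mul_mem_left ⟨j y, j y, e, by rw [h.right, h.right]⟩ _
      (hI.mul_mem_right ⟨e, e, e, by rw [h.idem, h.idem]⟩ _ hy)
    convert this using 1
    exact Subtype.ext (h.inv_left _).symm
  refine Set.eq_univ_of_forall ?_
  rintro ⟨_, s, t, rfl⟩
  have := hI.mul_mem_left ⟨s * e * e, s, e, rfl⟩ _ (hI.mul_mem_right ⟨e * e * t, e, t, rfl⟩ _ he)
  convert this using 1
  refine Subtype.ext ?_
  change s * e * t = (s * e * e) * (e * (e * e * t))
  simp only [mul_assoc, h.idem_assoc]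

theorem isMinimalIdempotent_of_mem {f : M} (hf : f ∈ twoSided e) (hff : IsIdempotentElem f) :
    IsMinimalIdempotent f := by
  refine ⟨hff, ?_⟩
  rintro g hg ⟨h1, h2⟩
  have hg' : g ∈ twoSided e := by
    rw [h1]; exact h.isTwoSidedIdeal.mul_mem_left _ _ hf
  -- An idempotent of $MeM$ is determined by its outer components, so it is enough that $g \le f$
  -- forces these to agree.
  have key : ∀ {f : M}, f ∈ twoSided e → IsIdempotentElem f →
      f = (f * j f) * (j ((j f * f) * (f * j f)) * (j f * f)) := by
    intro f hf hff
    have := h.idempotent_iff.1 ⟨hf, hff⟩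
    rw [idemRetract] at this
    simpa only [mul_assoc] using this.symm
  have ha : g * j g = f * j f := by
    have e1 : f * (g * j g) = g * j g := by rw [← mul_assoc, ← h2]
    have e2 := h.twoSided_iff.1 hf
    calc g * j g = (f * (j f * f)) * (g * j g) := by rw [e2, e1]
      _ = f * (j f * (e * (f * (g * j g)))) := by simp only [mul_assoc, h.right_assoc]
      _ = f * j f := by rw [e1, h.inv_right, h.right]
  have hb : j g * g = j f * f := by
    have e1 : (j g * g) * f = j g * g := by rw [mul_assoc, ← h1]
    have e2 := h.twoSided_iff.1 hf
    calc j g * g = (j g * g) * (f * (j f * f)) := by rw [e2, e1]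
      _ = ((j g * g) * f) * e * (j f * f) := by simp only [mul_assoc, h.left_assoc]
      _ = j f * f := by rw [e1, mul_assoc (j g), h.inv_left, h.left_assoc]
  rw [key hg' hg, key hf hff, ha, hb]

end IsCornerInversion

theorem IsCornerInversion.isMinimalIdempotent_iff {e : M} {j : M → M} (h : IsCornerInversion e j)
    (H : ∀ f : M, IsMinimalIdempotent f → ∃ j : M → M, IsCornerInversion f j) (f : M) :
    IsMinimalIdempotent f ↔ f ∈ twoSided e ∧ IsIdempotentElem f := by
  refine ⟨fun hf => ⟨?_, hf.idem⟩, fun hf => h.isMinimalIdempotent_of_mem hf.1 hf.2⟩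
  obtain ⟨i, hi⟩ := H f hf
  -- Inverting $fef$ in $fMf$ gives $f = i(e)\,e\,f$.
  exact ⟨i e, f, by rw [mul_assoc, hi.inv_left]⟩

theorem IsCornerInversion.twoSided_eq {e f : M} {j i : M → M} (h : IsCornerInversion e j)
    (h' : IsCornerInversion f i) : twoSided f = twoSided e :=
  SetLike.coe_injective (h'.isLeast.unique h.isLeast)

theorem IsCornerInversion.isCornerInv {e : M} {j : M → M} (h : IsCornerInversion e j) (s : M) :
    IsCornerInv e (e * s * e) (j s) where
  mem := h.inv_mem_corner s
  mul_eq := by simp only [mul_assoc, h.left, h.inv_right]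
  eq_mul := by simp only [mul_assoc, h.right_assoc, h.inv_left]

theorem IsCornerInversion.cornerInv_eq {e : M} {j : M → M} (h : IsCornerInversion e j) {s t : M}
    (hst : j s = j t) (hs : s = e * t * e) : cornerInv e s = j t := by
  have hex : ∃ u, IsCornerInv e s u := ⟨_, hs ▸ h.isCornerInv t⟩
  rw [cornerInv, dif_pos hex, ← hst]
  have := hex.choose_spec
  obtain ⟨h1, h2, h3⟩ := this
  refine (h.eq_of_inv ?_ ?_).symm
  · rw [h.corner_iff] at h1
    rw [← h1, h.idem_assoc]
  · rw [h2, h.idem]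

end SemigroupKernel

/-! ### Rational points and the Zariski topology -/

section Points

variable {k : Type u} [Field k] {X Y : Over (Spec (CommRingCat.of k))}

instance [IsVariety X] : IsReduced X.left := IsVariety.isReduced
instance [IsVariety X] : IsSeparated X.hom := IsVariety.isSeparated
instance [IsVariety X] : LocallyOfFiniteType X.hom := IsVariety.locallyOfFiniteType
instance [IsVariety X] : QuasiCompact X.hom := IsVariety.quasiCompact

theorem Pt.toScheme_map (f : X ⟶ Y) (p : Pt X) : (Pt.map f p).toScheme = f.left p.toScheme := by
  change (CommaMorphism.left p ≫ f.left) (IsLocalRing.closedPoint k) = _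
  rfl

theorem Pt.isInducing_toScheme : Topology.IsInducing (Pt.toScheme (X := X)) := ⟨rfl⟩

theorem Pt.continuous_map (f : X ⟶ Y) : Continuous (Pt.map f) := by
  rw [Pt.isInducing_toScheme.continuous_iff]
  have : Pt.toScheme ∘ Pt.map f = f.left ∘ Pt.toScheme := funext fun p => Pt.toScheme_map f p
  rw [this]
  exact f.left.continuous.comp Pt.isInducing_toScheme.continuous

theorem Pt.left_comp_hom (p : Pt X) :
    (show Spec (CommRingCat.of k) ⟶ X.left from CommaMorphism.left p) ≫ X.hom = 𝟙 _ := by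
  have := Over.w (show 𝟙_ (Over (Spec (CommRingCat.of k))) ⟶ X from p)
  simpa using this

variable [IsAlgClosed k]

theorem Pt.exists_toScheme_eq [LocallyOfFiniteType X.hom] {x : X.left} (hx : IsClosed {x}) :
    ∃ p : Pt X, p.toScheme = x := by
  refine ⟨Over.homMk (pointOfClosedPoint X.hom x hx) (by simp), ?_⟩
  exact pointOfClosedPoint_apply X.hom x hx _

theorem Pt.isClosed_toScheme [LocallyOfFiniteType X.hom] (p : Pt X) : IsClosed {p.toScheme} :=
  (pointEquivClosedPoint X.hom ⟨_, p.left_comp_hom⟩).2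

theorem Pt.toScheme_injective [LocallyOfFiniteType X.hom] :
    Function.Injective (Pt.toScheme (X := X)) := by
  intro p q h
  exact Over.OverMorphism.ext (ext_of_apply_closedPoint_eq X.hom p.left_comp_hom q.left_comp_hom h)

theorem Pt.range_toScheme [LocallyOfFiniteType X.hom] :
    Set.range (Pt.toScheme (X := X)) = closedPoints X.left := by
  ext x
  exact ⟨by rintro ⟨p, rfl⟩; exact p.isClosed_toScheme, fun hx => Pt.exists_toScheme_eq hx⟩

omit [IsAlgClosed k] in
theorem jacobsonSpace_left [LocallyOfFiniteType X.hom] : JacobsonSpace X.left :=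
  LocallyOfFiniteType.jacobsonSpace X.hom

/-- Rational points are dense in closed subsets. -/
theorem Pt.closure_image_preimage [LocallyOfFiniteType X.hom] {Z : Set X.left}
    (hZ : IsClosed Z) : closure (Pt.toScheme '' (Pt.toScheme (X := X) ⁻¹' Z)) = Z := by
  have := jacobsonSpace_left (X := X)
  rw [Set.image_preimage_eq_inter_range, Pt.range_toScheme,
    JacobsonSpace.closure_inter_closedPoints_eq_closure hZ.isLocallyClosed, hZ.closure_eq]

/-- Morphisms from a variety to a separated scheme are determined by rational points. -/
theorem Pt.hom_ext [IsReduced X.left] [LocallyOfFiniteType X.hom] [IsSeparated Y.hom]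
    [LocallyOfFiniteType Y.hom] {f g : X ⟶ Y} (h : ∀ p : Pt X, Pt.map f p = Pt.map g p) :
    f = g := by
  apply Over.OverMorphism.ext
  have : LocallyOfFiniteType (f.left ≫ Y.hom) := by rw [Over.w]; infer_instance
  refine ext_of_apply_eq Y.hom Set.univ isOpen_univ.isLocallyClosed dense_univ ?_ (by simp)
  intro x _ hx
  obtain ⟨p, rfl⟩ := Pt.exists_toScheme_eq hx
  rw [← Pt.toScheme_map, ← Pt.toScheme_map, h]

/-- The equalizer of morphisms to a separated scheme is a closed immersion, and the points in
question are those on its image. -/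
theorem Pt.isClosed_eq [LocallyOfFiniteType X.hom] [IsSeparated Y.hom] (f g : X ⟶ Y) :
    IsClosed {p : Pt X | Pt.map f p = Pt.map g p} := by
  have : IsClosedImmersion (Limits.equalizer.ι f g).left := inferInstance
  have hE := (Limits.equalizer.ι f g).left.isClosedEmbedding.isClosed_range
  convert hE.preimage Pt.isInducing_toScheme.continuous using 1
  ext p
  constructor
  · intro hp
    let q : Pt (Limits.equalizer f g) := Limits.equalizer.lift p hp
    refine ⟨q.toScheme, ?_⟩
    rw [← Pt.toScheme_map]
    congr 1
    exact Limits.equalizer.lift_ι _ _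
  · rintro ⟨y, hy⟩
    -- A closed point of the equalizer is rational, so it can be tested against the equalizer
    -- condition.
    have hy' : IsClosed {y} := by
      have h2 := p.isClosed_toScheme.preimage (Limits.equalizer.ι f g).left.continuous
      convert h2
      ext z
      simp only [Set.mem_singleton_iff, Set.mem_preimage, ← hy]
      exact (Limits.equalizer.ι f g).left.isClosedEmbedding.injective.eq_iff.symm
    have : LocallyOfFiniteType (Limits.equalizer f g).hom := by
      rw [← Over.w (Limits.equalizer.ι f g)]; infer_instance
    obtain ⟨q, rfl⟩ := Pt.exists_toScheme_eq hy'
    rw [← Pt.toScheme_map] at hy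
    rw [Set.mem_ofPred, ← Pt.toScheme_injective hy]
    exact congrArg (fun h => Pt.map h q) (Limits.equalizer.condition f g)

end Points

/-! ### Reduced closed subvarieties -/

section ClosedSubvariety

variable {k : Type u} [Field k] {X : Over (Spec (CommRingCat.of k))} (A : Set (Pt X))

theorem isReduced_subscheme_vanishingIdeal {X : Scheme.{u}} (Z : TopologicalSpace.Closeds X) :
    IsReduced (Scheme.IdealSheafData.vanishingIdeal Z).subscheme := by
  have hrad (U : X.affineOpens) :
      _root_.IsReduced (Γ(X, U) ⧸ (Scheme.IdealSheafData.vanishingIdeal Z).ideal U) := by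
    rw [← Ideal.isRadical_iff_quotient_reduced, Scheme.IdealSheafData.vanishingIdeal_ideal]
    exact PrimeSpectrum.isRadical_vanishingIdeal _
  have (U : (Scheme.IdealSheafData.vanishingIdeal Z).subschemeCover.openCover.I₀) :
      IsReduced ((Scheme.IdealSheafData.vanishingIdeal Z).subschemeCover.openCover.X U) := by
    have := hrad U
    exact inferInstanceAs (IsReduced (Spec (.of _)))
  exact IsReduced.of_openCover _
    (Scheme.IdealSheafData.vanishingIdeal Z).subschemeCover.openCover

instance : IsClosedImmersion (closedSubvariety.incl A).left :=
  inferInstanceAs (IsClosedImmersion (Scheme.IdealSheafData.vanishingIdeal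
      (TopologicalSpace.Closeds.closure (Pt.toScheme '' A))).subschemeι)

instance : Mono (closedSubvariety.incl A) :=
  (Over.forget _).mono_of_mono_map
    (inferInstanceAs (Mono (closedSubvariety.incl A).left))

instance [LocallyOfFiniteType X.hom] : LocallyOfFiniteType (closedSubvariety A).hom := by
  rw [← Over.w (closedSubvariety.incl A)]; infer_instance

instance [IsSeparated X.hom] : IsSeparated (closedSubvariety A).hom := by
  rw [← Over.w (closedSubvariety.incl A)]; infer_instance

instance [QuasiCompact X.hom] : QuasiCompact (closedSubvariety A).hom := by
  rw [← Over.w (closedSubvariety.incl A)]; infer_instance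

instance : IsReduced (closedSubvariety A).left :=
  isReduced_subscheme_vanishingIdeal _

instance [IsVariety X] : IsVariety (closedSubvariety A) where
  isReduced := inferInstance
  isSeparated := inferInstance
  locallyOfFiniteType := inferInstance
  quasiCompact := inferInstance

theorem closedSubvariety.ker_incl_left : (closedSubvariety.incl A).left.ker =
    Scheme.IdealSheafData.vanishingIdeal (TopologicalSpace.Closeds.closure (Pt.toScheme '' A)) :=
  Scheme.IdealSheafData.ker_subschemeι _

theorem closedSubvariety.range_incl_left :
    Set.range (closedSubvariety.incl A).left = closure (Pt.toScheme '' A) := by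
  refine (Scheme.IdealSheafData.range_subschemeι
    (Scheme.IdealSheafData.vanishingIdeal
      (TopologicalSpace.Closeds.closure (Pt.toScheme '' A)))).trans ?_
  simp

theorem Pt.incl_mem [IsAlgClosed k] {A : Set (Pt X)} (hA : IsClosed A)
    (p : Pt (closedSubvariety A)) : p.incl ∈ A := by
  refine hA.closure_subset ?_
  rw [Pt.isInducing_toScheme.closure_eq_preimage_closure_image, Set.mem_preimage,
    ← closedSubvariety.range_incl_left, Pt.incl, Pt.toScheme_map]
  exact ⟨_, rfl⟩

theorem Pt.incl_injective {A : Set (Pt X)} :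
    Function.Injective (Pt.incl (A := A)) := by
  intro p q h
  exact (cancel_mono (closedSubvariety.incl A)).1 h

/-- The kernel is radical because the source is reduced, so only its support matters. Set-theoretic
containment thus suffices to factor through a reduced closed subscheme. -/
theorem vanishingIdeal_le_ker {X Y : Scheme.{u}} [IsReduced X] (f : X ⟶ Y) [QuasiCompact f]
    (Z : TopologicalSpace.Closeds Y) (h : Set.range f ⊆ Z) :
    Scheme.IdealSheafData.vanishingIdeal Z ≤ f.ker := by
  have h1 : f.ker.support ≤ Z := by
    rw [← SetLike.coe_subset_coe, Scheme.Hom.support_ker]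
    exact Z.isClosed.closure_subset_iff.2 h
  refine (Scheme.IdealSheafData.vanishingIdeal_antimono h1).trans ?_
  rw [Scheme.IdealSheafData.vanishingIdeal_support]
  intro U
  rw [Scheme.IdealSheafData.radical_ideal, Scheme.Hom.ker_apply]
  have : (RingHom.ker (f.app U).hom).IsRadical := Ideal.isRadical_bot.comap _
  exact this

end ClosedSubvariety

/-! ### Fixed points of idempotent endomorphisms -/

section Retraction

variable {k : Type u} [Field k] [IsAlgClosed k] {X : Over (Spec (CommRingCat.of k))}

/-- The image of an idempotent endomorphism of a variety is a closed subvariety, and a retract. -/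
theorem exists_retraction [IsVariety X] (r : X ⟶ X) (hr : r ≫ r = r) (A : Set (Pt X))
    (hA : ∀ p, p ∈ A ↔ Pt.map r p = p) :
    IsClosed A ∧ ∃ q : X ⟶ closedSubvariety A,
      q ≫ closedSubvariety.incl A = r ∧ closedSubvariety.incl A ≫ q = 𝟙 _ := by
  have hcl : IsClosed A := by
    convert Pt.isClosed_eq r (𝟙 X) using 1
    ext p
    rw [hA, Set.mem_ofPred]
    exact ⟨fun h => h.trans (Category.comp_id _).symm, fun h => h.trans (Category.comp_id _)⟩
  have : QuasiCompact (r.left ≫ X.hom) := by rw [Over.w]; infer_instance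
  have : QuasiCompact r.left := .of_comp _ X.hom
  -- Rational points are dense, and $r$ sends them into $A$ because $r^2 = r$.
  have hrange : Set.range r.left ⊆ closure (Pt.toScheme '' A) := by
    have hd := Pt.closure_image_preimage (X := X) isClosed_univ
    rw [← Set.image_univ, ← hd]
    refine (image_closure_subset_closure_image r.left.continuous).trans (closure_mono ?_)
    rintro _ ⟨_, ⟨p, -, rfl⟩, rfl⟩
    rw [← Pt.toScheme_map]
    refine ⟨_, (hA _).2 ?_, rfl⟩
    exact congrArg (fun f => Pt.map f p) hr
  have hker : (closedSubvariety.incl A).left.ker ≤ r.left.ker := by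
    rw [closedSubvariety.ker_incl_left]
    exact vanishingIdeal_le_ker _ _ hrange
  refine ⟨hcl, Over.homMk (IsClosedImmersion.lift _ r.left hker) ?_, ?_, ?_⟩
  · rw [← Over.w (closedSubvariety.incl A), IsClosedImmersion.lift_fac_assoc, Over.w]
  · apply Over.OverMorphism.ext
    exact IsClosedImmersion.lift_fac _ r.left hker
  · rw [← cancel_mono (closedSubvariety.incl A)]
    refine Pt.hom_ext fun p => ?_
    have hq : IsClosedImmersion.lift _ r.left hker ≫ (closedSubvariety.incl A).left = r.left :=
      IsClosedImmersion.lift_fac _ r.left hker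
    have : (Over.homMk (IsClosedImmersion.lift _ r.left hker) (by
        rw [← Over.w (closedSubvariety.incl A), IsClosedImmersion.lift_fac_assoc, Over.w]) :
        X ⟶ closedSubvariety A) ≫ closedSubvariety.incl A = r := Over.OverMorphism.ext hq
    rw [Category.assoc, this, Category.id_comp]
    exact (hA _).1 (Pt.incl_mem hcl p)

end Retraction

/-! ### Topology of constructible sets -/

section Constructible

open Topology

variable {X : Type*} [TopologicalSpace X]

/-- A constructible set contains an open dense subset of its closure. -/
theorem Topology.IsConstructible.exists_isOpen_inter_closure_subset {D : Set X}
    (hD : IsConstructible D) {W : Set X} (hW : IsOpen W) (hWD : (W ∩ D).Nonempty) :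
    ∃ O ⊆ W, IsOpen O ∧ (O ∩ D).Nonempty ∧ O ∩ closure D ⊆ D := by
  have hunion : ∀ s t : Set X,
      (∀ W : Set X, IsOpen W → (W ∩ s).Nonempty →
        ∃ O ⊆ W, IsOpen O ∧ (O ∩ s).Nonempty ∧ O ∩ closure s ⊆ s) →
      (∀ W : Set X, IsOpen W → (W ∩ t).Nonempty →
        ∃ O ⊆ W, IsOpen O ∧ (O ∩ t).Nonempty ∧ O ∩ closure t ⊆ t) →
      ∀ W : Set X, IsOpen W → (W ∩ s).Nonempty →
        ∃ O ⊆ W, IsOpen O ∧ (O ∩ (s ∪ t)).Nonempty ∧ O ∩ closure (s ∪ t) ⊆ s ∪ t := by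
    intro s t hs ht W hW hWs
    -- Either $t$ adds nothing to the closure of $s$ inside $W$, and the open set found for $s$
    -- works, or $t$ meets the open complement of that closure in $W$, where $s$ plays no role.
    by_cases hts : W ∩ t ⊆ closure s
    · obtain ⟨O, hOW, hO, ⟨x, hxO, hxs⟩, hOs⟩ := hs W hW hWs
      refine ⟨O, hOW, hO, ⟨x, hxO, .inl hxs⟩, ?_⟩
      rintro y ⟨hyO, hy⟩
      rw [closure_union] at hy
      refine .inl (hOs ⟨hyO, hy.elim id fun hyt => ?_⟩)
      have := hO.inter_closure ⟨hyO, hyt⟩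
      exact closure_minimal ((Set.inter_subset_inter_left t hOW).trans hts) isClosed_closure this
    · rw [Set.not_subset] at hts
      obtain ⟨x, ⟨hxW, hxt⟩, hxs⟩ := hts
      obtain ⟨O, hOW, hO, ⟨y, hyO, hyt⟩, hOt⟩ := ht (W ∩ (closure s)ᶜ)
        (hW.inter isClosed_closure.isOpen_compl) ⟨x, ⟨hxW, hxs⟩, hxt⟩
      refine ⟨O, hOW.trans Set.inter_subset_left, hO, ⟨y, hyO, .inr hyt⟩, ?_⟩
      rintro z ⟨hzO, hz⟩
      rw [closure_union] at hz
      exact .inr (hOt ⟨hzO, hz.resolve_left (hOW hzO).2⟩)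
  induction D, hD using BooleanSubalgebra.closure_sdiff_sup_induction generalizing W with
  | isSublattice =>
    exact ⟨fun s hs t ht ↦ ⟨hs.1.union ht.1, hs.2.union ht.2⟩,
      fun s hs t ht ↦ ⟨hs.1.inter ht.1, hs.2.inter_isOpen ht.2 ht.1⟩⟩
  | bot_mem => exact ⟨isOpen_empty, .empty⟩
  | top_mem => exact ⟨isOpen_univ, .univ⟩
  | sdiff U hU V hV =>
    obtain ⟨x, hxW, hxU, hxV⟩ := hWD
    refine ⟨W ∩ U, Set.inter_subset_left, hW.inter hU.1, ⟨x, ⟨hxW, hxU⟩, hxU, hxV⟩, ?_⟩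
    rintro y ⟨⟨-, hyU⟩, hy⟩
    exact ⟨hyU, closure_minimal (fun z hz => hz.2) hV.1.isClosed_compl hy⟩
  | sup s _ t _ hs' ht' =>
    obtain ⟨x, hxW, hxs | hxt⟩ := hWD
    · exact hunion s t (fun W hW h => hs' hW h) (fun W hW h => ht' hW h) W hW ⟨x, hxW, hxs⟩
    · have := hunion t s (fun W hW h => ht' hW h) (fun W hW h => hs' hW h) W hW ⟨x, hxW, hxt⟩
      rwa [Set.union_comm] at this

/-- $D$ contains a nonempty relatively open part of its closure, which the dense subset $A$ must
meet. -/
theorem Topology.IsConstructible.nonempty_inter_of_closure {D A : Set X} (hD : IsConstructible D)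
    (hne : D.Nonempty) (h1 : A ⊆ closure D) (h2 : D ⊆ closure A) : (A ∩ D).Nonempty := by
  obtain ⟨O, -, hO, ⟨x, hxO, hxD⟩, hOD⟩ :=
    hD.exists_isOpen_inter_closure_subset isOpen_univ (by simpa using hne)
  obtain ⟨a, haO, haA⟩ := mem_closure_iff.1 (h2 hxD) O hO hxO
  exact ⟨a, haA, hOD ⟨haO, h1 haA⟩⟩

theorem Topology.IsConstructible.nonempty_inter_closedPoints [JacobsonSpace X] {D : Set X}
    (hD : IsConstructible D) (hne : D.Nonempty) : (D ∩ closedPoints X).Nonempty := by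
  obtain ⟨O, -, hO, ⟨x, hxO, hxD⟩, hOD⟩ :=
    hD.exists_isOpen_inter_closure_subset isOpen_univ (by simpa using hne)
  have := _root_.nonempty_inter_closedPoints (Z := O ∩ closure D) ⟨x, hxO, subset_closure hxD⟩
    (hO.isLocallyClosed.inter isClosed_closure.isLocallyClosed)
  exact this.mono (Set.inter_subset_inter_left _ hOD)

theorem IsClosed.isConstructible_of_noetherianSpace [TopologicalSpace.NoetherianSpace X]
    {Z : Set X} (hZ : IsClosed Z) : IsConstructible Z := by
  rw [← isConstructible_compl]
  refine IsRetrocompact.isConstructible hZ.isOpen_compl ?_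
  intro U _ _
  exact TopologicalSpace.NoetherianSpace.isCompact _

end Constructible

/-! ### Chevalley's theorem on rational points -/

section Chevalley

variable {k : Type u} [Field k] {X Y : Over (Spec (CommRingCat.of k))}

theorem isNoetherian_left [LocallyOfFiniteType X.hom] [QuasiCompact X.hom] :
    IsNoetherian X.left where
  toIsLocallyNoetherian := LocallyOfFiniteType.isLocallyNoetherian X.hom
  toCompactSpace := (quasiCompact_iff_compactSpace (f := X.hom)).1 inferInstance

theorem isConstructible_image_left [LocallyOfFiniteType X.hom] [QuasiCompact X.hom]
    [LocallyOfFiniteType Y.hom] [QuasiCompact Y.hom] (f : X ⟶ Y) {Z : Set X.left}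
    (hZ : Topology.IsConstructible Z) : Topology.IsConstructible (f.left '' Z) := by
  have := isNoetherian_left (X := X)
  have := isNoetherian_left (X := Y)
  have : LocallyOfFiniteType (f.left ≫ Y.hom) := by rw [Over.w]; infer_instance
  have : LocallyOfFiniteType f.left := locallyOfFiniteType_of_comp _ Y.hom
  exact f.left.isConstructible_image hZ

instance [LocallyOfFiniteType X.hom] [LocallyOfFiniteType Y.hom] :
    LocallyOfFiniteType (X ⊗ Y).hom := by dsimp; infer_instance

instance [QuasiCompact X.hom] [QuasiCompact Y.hom] : QuasiCompact (X ⊗ Y).hom := by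
  dsimp; infer_instance

instance [IsSeparated X.hom] [IsSeparated Y.hom] : IsSeparated (X ⊗ Y).hom := by
  dsimp; infer_instance

variable [IsAlgClosed k]

/-- By Chevalley the image of the scheme-theoretic closure of $Z$ is constructible, so it contains
some point of $A$. -/
theorem Pt.nonempty_inter_image [LocallyOfFiniteType X.hom] [QuasiCompact X.hom]
    [LocallyOfFiniteType Y.hom] [QuasiCompact Y.hom] (f : X ⟶ Y) {Z : Set (Pt X)}
    (hZ : IsClosed Z) (hne : Z.Nonempty) {A : Set (Pt Y)} (h1 : A ⊆ closure (Pt.map f '' Z))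
    (h2 : Pt.map f '' Z ⊆ closure A) : (A ∩ Pt.map f '' Z).Nonempty := by
  have := isNoetherian_left (X := X)
  have := jacobsonSpace_left (X := X)
  have hcl {V : Over (Spec (CommRingCat.of k))} (B : Set (Pt V)) :
      closure B = Pt.toScheme ⁻¹' closure (Pt.toScheme '' B) :=
    Pt.isInducing_toScheme.closure_eq_preimage_closure_image B
  have hcomm : Pt.toScheme '' (Pt.map f '' Z) = f.left '' (Pt.toScheme '' Z) := by
    rw [Set.image_image, Set.image_image]
    exact Set.image_congr fun p _ => Pt.toScheme_map f p
  have hD := isConstructible_image_left f (Z := closure (Pt.toScheme '' Z))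
    isClosed_closure.isConstructible_of_noetherianSpace
  have hA1 : Pt.toScheme '' A ⊆ closure (f.left '' closure (Pt.toScheme '' Z)) := by
    rw [Set.image_subset_iff]
    refine h1.trans ?_
    rw [hcl, hcomm]
    exact Set.preimage_mono (closure_mono (Set.image_mono subset_closure))
  have hA2 : f.left '' closure (Pt.toScheme '' Z) ⊆ closure (Pt.toScheme '' A) := by
    refine (image_closure_subset_closure_image f.left.continuous).trans ?_
    refine closure_minimal ?_ isClosed_closure
    rw [← hcomm, Set.image_subset_iff, ← hcl]
    exact h2
  obtain ⟨_, ⟨a, ha, rfl⟩, z, hz, hza⟩ :=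
    hD.nonempty_inter_of_closure ((hne.image _).closure.image _) hA1 hA2
  -- The preimage so far is only a scheme point; the fibre over the closed point $a$ is closed and
  -- nonempty, so it has a rational point.
  obtain ⟨z', ⟨hz1, hz2⟩, hz3⟩ := nonempty_inter_closedPoints
    (Z := closure (Pt.toScheme '' Z) ∩ f.left ⁻¹' {a.toScheme}) ⟨z, hz, hza⟩
    (isClosed_closure.inter (a.isClosed_toScheme.preimage f.left.continuous)).isLocallyClosed
  obtain ⟨p, rfl⟩ := Pt.exists_toScheme_eq hz3
  refine ⟨a, ha, p, ?_, Pt.toScheme_injective ?_⟩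
  · rw [← hZ.closure_eq, hcl]
    exact hz1
  · rw [Pt.toScheme_map]; exact hz2

theorem surjective_left_of_surjective_map [LocallyOfFiniteType X.hom] [QuasiCompact X.hom]
    [LocallyOfFiniteType Y.hom] [QuasiCompact Y.hom] (f : X ⟶ Y)
    (h : Function.Surjective (Pt.map f)) : Surjective f.left := by
  have := jacobsonSpace_left (X := Y)
  have hD := (isConstructible_image_left f .univ).compl
  refine ⟨fun y => ?_⟩
  by_contra hy
  obtain ⟨y', hy1, hy2⟩ := hD.nonempty_inter_closedPoints ⟨y, by simpa using hy⟩
  obtain ⟨p, rfl⟩ := Pt.exists_toScheme_eq hy2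
  obtain ⟨q, rfl⟩ := h p
  rw [Pt.toScheme_map] at hy1
  exact hy1 ⟨_, trivial, rfl⟩

end Chevalley

/-! ### Rational points of products -/

section PointMaps

variable {k : Type u} [Field k] {X Y Z : Over (Spec (CommRingCat.of k))}

theorem Pt.map_comp (f : X ⟶ Y) (g : Y ⟶ Z) (p : Pt X) :
    Pt.map (f ≫ g) p = Pt.map g (Pt.map f p) := (Category.assoc _ _ _).symm

theorem Pt.map_id (p : Pt X) : Pt.map (𝟙 X) p = p := Category.comp_id _

theorem Pt.map_fst_pair (p : Pt X) (q : Pt Y) : Pt.map (fst X Y) (p.pair q) = p := lift_fst _ _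

theorem Pt.map_snd_pair (p : Pt X) (q : Pt Y) : Pt.map (snd X Y) (p.pair q) = q := lift_snd _ _

theorem Pt.map_lift (f : X ⟶ Y) (g : X ⟶ Z) (p : Pt X) :
    Pt.map (lift f g) p = (Pt.map f p).pair (Pt.map g p) := comp_lift _ _ _

theorem Pt.eq_pair (p : Pt (X ⊗ Y)) : p = (Pt.map (fst X Y) p).pair (Pt.map (snd X Y) p) := by
  rw [← Pt.map_lift, lift_fst_snd, Pt.map_id]

/-- The constant morphism with value a rational point. -/
noncomputable def Pt.const (X : Over (Spec (CommRingCat.of k))) (p : Pt Y) : X ⟶ Y :=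
  toUnit X ≫ (show 𝟙_ (Over (Spec (CommRingCat.of k))) ⟶ Y from p)

theorem Pt.map_const (p : Pt Y) (q : Pt X) : Pt.map (Pt.const X p) q = p := by
  have h : (show 𝟙_ (Over (Spec (CommRingCat.of k))) ⟶ X from q) ≫ toUnit X = 𝟙 _ :=
    toUnit_unique _ _
  have h' := congrArg (fun f => f ≫ (show 𝟙_ (Over (Spec (CommRingCat.of k))) ⟶ Y from p)) h
  exact (Category.assoc _ _ _).symm.trans (h'.trans (Category.id_comp _))

/-- `Pt (X ⊗ Y)` carries the Zariski topology, not the product topology, so density arguments have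
to proceed one variable at a time. -/
theorem Pt.continuous_pair_left (p : Pt X) : Continuous (fun q : Pt Y => p.pair q) := by
  have : (fun q : Pt Y => p.pair q) = Pt.map (lift (Pt.const Y p) (𝟙 Y)) := by
    funext q; rw [Pt.map_lift, Pt.map_const, Pt.map_id]
  rw [this]; exact Pt.continuous_map _

theorem Pt.continuous_pair_right (q : Pt Y) : Continuous (fun p : Pt X => p.pair q) := by
  have : (fun p : Pt X => p.pair q) = Pt.map (lift (𝟙 X) (Pt.const X q)) := by
    funext q; rw [Pt.map_lift, Pt.map_const, Pt.map_id]
  rw [this]; exact Pt.continuous_map _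

theorem Pt.mul_def [SemigroupObj X] (p q : Pt X) :
    p * q = Pt.map SemigroupObj.mul (p.pair q) := rfl

end PointMaps

/-! ### Powers of a point, and invertibility in $eSe$ -/

namespace SemigroupKernel

section Abstract

variable {M : Type*} [Semigroup M]

/-- The sequence of powers `n ↦ x ^ (n + 1)` in a semigroup. -/
def powSucc (x : M) : ℕ → M
  | 0 => x
  | n + 1 => powSucc x n * x

theorem powSucc_add (x : M) (m n : ℕ) : powSucc x (m + n + 1) = powSucc x m * powSucc x n := by
  induction n with
  | zero => rfl
  | succ n ih =>
    change powSucc x (m + n + 1) * x = powSucc x m * (powSucc x n * x)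
    rw [ih, mul_assoc]

theorem powSucc_mul_comm (x : M) (n : ℕ) : powSucc x n * x = x * powSucc x n := by
  have h1 := powSucc_add x n 0
  have h2 := powSucc_add x 0 n
  rw [Nat.zero_add] at h2
  exact h1.symm.trans h2

/-- With $u = x^m b$ the relation reads $x^{j+1} = x^{j+1}(xu)$. Iterating it $j+1$ times shows that
$x^{j+1}u^{j+1}$ is idempotent, hence $1$. -/
theorem exists_inv_of_monoid {N : Type*} [Monoid N] (hN : ∀ f : N, f * f = f → f = 1) (x b : N)
    (hxb : Commute x b) (j m : ℕ) (h : x ^ (j + 1) = x ^ (j + m + 1 + 1) * b) :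
    ∃ y : N, x * y = 1 ∧ y * x = 1 := by
  have hxu : Commute x (x ^ m * b) := ((Commute.refl x).pow_right m).mul_right hxb
  have hstep : x ^ (j + 1) = x ^ (j + 1) * (x * (x ^ m * b)) := by
    conv_lhs => rw [h]
    rw [show j + m + 1 + 1 = (j + 1) + 1 + m by ring, pow_add, pow_add, pow_one]
    simp only [mul_assoc]
  have hn : ∀ n, x ^ (j + 1) = x ^ (j + 1) * (x * (x ^ m * b)) ^ n := by
    intro n
    induction n with
    | zero => simp
    | succ n ih => rw [pow_succ (x * (x ^ m * b)), ← mul_assoc, ← ih, ← hstep]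
  set u := x ^ m * b with hu
  have hidem : x ^ (j + 1) * u ^ (j + 1) = 1 := by
    apply hN
    have hc : Commute (u ^ (j + 1)) (x ^ (j + 1)) := (hxu.pow_pow _ _).symm
    calc x ^ (j + 1) * u ^ (j + 1) * (x ^ (j + 1) * u ^ (j + 1))
        = x ^ (j + 1) * (x ^ (j + 1) * u ^ (j + 1)) * u ^ (j + 1) := by
          rw [mul_assoc, ← mul_assoc (u ^ (j + 1)), hc.eq]; simp only [mul_assoc]
      _ = x ^ (j + 1) * u ^ (j + 1) :=
          congrArg (· * u ^ (j + 1)) (by rw [← hxu.mul_pow, ← hn])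
  refine ⟨x ^ j * u ^ (j + 1), ?_, ?_⟩
  · rw [← mul_assoc, ← pow_succ', hidem]
  · rw [mul_assoc, ← (hxu.pow_right (j + 1)).eq, ← mul_assoc, ← pow_succ, hidem]

theorem IsMinimalIdempotent.exists_inv {e : M} (he : IsMinimalIdempotent e) {x b : M}
    (hx1 : e * x = x) (hx2 : x * e = x) (hb1 : e * b = b) (hb2 : b * e = b)
    (hxb : x * b = b * x) (j m : ℕ) (h : powSucc x j = powSucc x (j + m + 1) * b) :
    ∃ y, e * y = y ∧ y * e = y ∧ x * y = e ∧ y * x = e := by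
  have hee : e * e = e := he.idem
  -- The idempotents of this monoid are exactly those below $e$, so minimality leaves only its unit.
  let N := {z : M // e * z = z ∧ z * e = z}
  let _ : Monoid N :=
    { mul := fun a b => ⟨a.1 * b.1, by rw [← mul_assoc, a.2.1], by rw [mul_assoc, b.2.2]⟩
      mul_assoc := fun a b c => Subtype.ext (mul_assoc _ _ _)
      one := ⟨e, hee, hee⟩
      one_mul := fun a => Subtype.ext a.2.1
      mul_one := fun a => Subtype.ext a.2.2 }
  have hpow : ∀ (z : N) (n : ℕ), (z ^ (n + 1)).1 = powSucc z.1 n := by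
    intro z n
    induction n with
    | zero => rw [zero_add, pow_one]; rfl
    | succ n ih =>
      rw [pow_succ]
      change (z ^ (n + 1)).1 * z.1 = powSucc z.1 n * z.1
      rw [ih]
  obtain ⟨y, h1, h2⟩ := exists_inv_of_monoid (N := N) (fun f hf => Subtype.ext
      (he.eq_of_le f.1 (congrArg Subtype.val hf) ⟨f.2.2.symm, f.2.1.symm⟩))
    ⟨x, hx1, hx2⟩ ⟨b, hb1, hb2⟩ (Subtype.ext hxb) j m (Subtype.ext (by
      change _ = (_ ^ (j + m + 1 + 1) : N).1 * b
      rw [hpow, hpow, h]))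
  exact ⟨y.1, y.2.1, y.2.2, congrArg Subtype.val h1, congrArg Subtype.val h2⟩

end Abstract

section Points

variable {k : Type u} [Field k] [IsAlgClosed k] {S : Over (Spec (CommRingCat.of k))}
  [SemigroupObj S]

omit [IsAlgClosed k] in
theorem continuous_mul_left' (p : Pt S) : Continuous (fun q : Pt S => p * q) :=
  (Pt.continuous_map _).comp (Pt.continuous_pair_left p)

omit [IsAlgClosed k] in
theorem continuous_mul_right' (q : Pt S) : Continuous (fun p : Pt S => p * q) :=
  (Pt.continuous_map _).comp (Pt.continuous_pair_right q)

theorem isClosed_eq_of_mul [LocallyOfFiniteType S.hom] [IsSeparated S.hom] (p : Pt S) :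
    IsClosed {q : Pt S | p * q = q * p} := by
  have := Pt.isClosed_eq (lift (Pt.const S p) (𝟙 S) ≫ SemigroupObj.mul)
    (lift (𝟙 S) (Pt.const S p) ≫ SemigroupObj.mul)
  simpa only [Pt.map_comp, Pt.map_lift, Pt.map_const, Pt.map_id, ← Pt.mul_def] using this

theorem isClosed_mul_left_eq [LocallyOfFiniteType S.hom] [IsSeparated S.hom] (p : Pt S) :
    IsClosed {q : Pt S | p * q = q} := by
  have := Pt.isClosed_eq (lift (Pt.const S p) (𝟙 S) ≫ SemigroupObj.mul) (𝟙 S)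
  simpa only [Pt.map_comp, Pt.map_lift, Pt.map_const, Pt.map_id, ← Pt.mul_def] using this

theorem isClosed_mul_right_eq [LocallyOfFiniteType S.hom] [IsSeparated S.hom] (p : Pt S) :
    IsClosed {q : Pt S | q * p = q} := by
  have := Pt.isClosed_eq (lift (𝟙 S) (Pt.const S p) ≫ SemigroupObj.mul) (𝟙 S)
  simpa only [Pt.map_comp, Pt.map_lift, Pt.map_const, Pt.map_id, ← Pt.mul_def] using this

/-- Strong `π`-regularity of algebraic semigroups: some power of `x` is divisible by a higher
power of `x`, with a quotient in the closure of the powers of `x`. -/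
theorem exists_powSucc_eq [LocallyOfFiniteType S.hom] [QuasiCompact S.hom] (x : Pt S) :
    ∃ j m : ℕ, ∃ b ∈ closure (Set.range (powSucc x)),
      powSucc x j = powSucc x (j + m + 1) * b := by
  set c := powSucc x with hc
  have hnoeth : TopologicalSpace.NoetherianSpace (Pt S) := by
    have := isNoetherian_left (X := S)
    exact Pt.isInducing_toScheme.noetherianSpace
  have hwf : WellFoundedLT (TopologicalSpace.Closeds (Pt S)) :=
    (TopologicalSpace.noetherianSpace_TFAE (Pt S)).out 0 1 |>.1 hnoeth
  -- Descending chains of closed sets stabilise, so every later tail is dense in $T$.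
  obtain ⟨N, hN⟩ : ∃ N, ∀ n, N ≤ n → closure (c '' Set.Ici N) = closure (c '' Set.Ici n) := by
    obtain ⟨N, hN⟩ := WellFoundedGT.monotone_chain_condition
      (α := (TopologicalSpace.Closeds (Pt S))ᵒᵈ)
      ⟨fun n => OrderDual.toDual (TopologicalSpace.Closeds.closure (c '' Set.Ici n)),
        fun a b hab => closure_mono (Set.image_mono (Set.Ici_subset_Ici.2 hab))⟩
    exact ⟨N, fun n hn => congrArg SetLike.coe (OrderDual.toDual.injective (hN n hn))⟩
  set T := closure (c '' Set.Ici N) with hT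
  have hTcl : IsClosed T := isClosed_closure
  have hcT : ∀ n, N ≤ n → c n ∈ T := fun n hn => subset_closure ⟨n, hn, rfl⟩
  have hadd : ∀ m n, c (m + n + 1) = c m * c n := powSucc_add x
  have hmul1 : ∀ i, N ≤ i → ∀ b ∈ T, c i * b ∈ T := by
    intro i hi b hb
    refine closure_minimal ?_ (hTcl.preimage (continuous_mul_left' (c i))) hb
    rintro _ ⟨n, -, rfl⟩
    rw [Set.mem_preimage, ← hadd]
    exact hcT _ (by omega)
  have hmul : ∀ a ∈ T, ∀ b ∈ T, a * b ∈ T := by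
    intro a ha b hb
    refine closure_minimal ?_ (hTcl.preimage (continuous_mul_right' b)) ha
    rintro _ ⟨n, hn, rfl⟩
    exact hmul1 n hn b hb
  let f : S ⊗ S ⟶ S ⊗ S := lift (fst S S) SemigroupObj.mul
  have hf : ∀ a b : Pt S, Pt.map f (a.pair b) = a.pair (a * b) := by
    intro a b
    rw [Pt.map_lift, Pt.map_fst_pair, Pt.mul_def]
  let Z : Set (Pt (S ⊗ S)) := {z | Pt.map (fst S S) z ∈ T ∧ Pt.map (snd S S) z ∈ T}
  have hZ : IsClosed Z := (hTcl.preimage (Pt.continuous_map _)).inter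
    (hTcl.preimage (Pt.continuous_map _))
  have hZmem : ∀ a ∈ T, ∀ b ∈ T, a.pair b ∈ Z := fun a ha b hb =>
    ⟨by rwa [Pt.map_fst_pair], by rwa [Pt.map_snd_pair]⟩
  -- The first exponent is strictly larger, so a point of $A$ in $f(T \times T)$ is the divisibility
  -- sought. It exists once $A$ and $f(T \times T)$ lie in each other's closure.
  let A : Set (Pt (S ⊗ S)) := {z | ∃ j m, N ≤ j ∧ z = (c (j + m + 1)).pair (c j)}
  have hdense : ∀ a ∈ T, ∀ d ∈ T, a.pair d ∈ closure A := by
    intro a ha d hd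
    refine closure_minimal ?_ (isClosed_closure.preimage (Pt.continuous_pair_left a)) hd
    rintro _ ⟨n, hn, rfl⟩
    -- With the second entry fixed at $c_n$, the first may run over the tail beyond $n$, which is
    -- still dense in $T$.
    rw [hN (n + 1) (by rw [Set.mem_Ici] at hn; omega)] at ha
    refine closure_minimal ?_ (isClosed_closure.preimage (Pt.continuous_pair_right (c n))) ha
    rintro _ ⟨i, hi, rfl⟩
    rw [Set.mem_Ici] at hi
    obtain ⟨m, rfl⟩ := Nat.exists_eq_add_of_le hi
    exact subset_closure ⟨n, m, hn, by rw [show n + 1 + m = n + m + 1 by ring]⟩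
  obtain ⟨_, ⟨j, m, hj, rfl⟩, z, hz, hzeq⟩ :=
    Pt.nonempty_inter_image f hZ ⟨_, hZmem _ (hcT N le_rfl) _ (hcT N le_rfl)⟩ (A := A)
      (by
        rintro _ ⟨j, m, hj, rfl⟩
        have hjT := hcT j hj
        -- Approximate $c_j$ by powers late enough to be $c_{j+m+1}$ times a member of the tail from
        -- $N$.
        rw [hN (j + m + 1 + N + 1) (by omega)] at hjT
        refine closure_minimal ?_
          (isClosed_closure.preimage (Pt.continuous_pair_left (c (j + m + 1)))) hjT
        rintro _ ⟨i, hi, rfl⟩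
        rw [Set.mem_Ici] at hi
        obtain ⟨l, rfl⟩ := Nat.exists_eq_add_of_le hi
        refine subset_closure ⟨(c (j + m + 1)).pair (c (N + l)),
          hZmem _ (hcT _ (by omega)) _ (hcT _ (by omega)), ?_⟩
        rw [hf, ← hadd]
        congr 2
        ring)
      (by
        rintro _ ⟨z, hz, rfl⟩
        rw [Pt.eq_pair z, hf]
        exact hdense _ hz.1 _ (hmul _ hz.1 _ hz.2))
  rw [Pt.eq_pair z, hf] at hzeq
  have h1 := congrArg (Pt.map (fst S S)) hzeq
  have h2 := congrArg (Pt.map (snd S S)) hzeq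
  rw [Pt.map_fst_pair, Pt.map_fst_pair] at h1
  rw [Pt.map_snd_pair, Pt.map_snd_pair] at h2
  refine ⟨j, m, _, closure_mono (Set.image_subset_range _ _) hz.2, ?_⟩
  rw [← h2, h1]

/-- The monoid `eSe` of rational points is a group if `e` is a minimal idempotent. -/
theorem IsMinimalIdempotent.exists_isCornerInversion [IsVariety S] {e : Pt S}
    (he : IsMinimalIdempotent e) : ∃ j : Pt S → Pt S, IsCornerInversion e j := by
  have hee : e * e = e := he.idem
  have key : ∀ s : Pt S, ∃ y, e * y = y ∧ y * e = y ∧ (e * s * e) * y = e ∧ y * (e * s * e) = e := by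
    intro s
    set x := e * s * e with hx
    have hx1 : e * x = x := by simp only [hx, ← mul_assoc, hee]
    have hx2 : x * e = x := by simp only [hx, mul_assoc, hee]
    obtain ⟨j, m, b, hb, h⟩ := exists_powSucc_eq x
    have hp1 : ∀ n, e * powSucc x n = powSucc x n := by
      intro n
      induction n with
      | zero => exact hx1
      | succ n ih => rw [powSucc, ← mul_assoc, ih]
    have hp2 : ∀ n, powSucc x n * e = powSucc x n := by
      intro n
      cases n with
      | zero => exact hx2
      | succ n => rw [powSucc, mul_assoc, hx2]
    -- The three conditions on $b$ are closed and hold for the powers of $x$, hence on their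
    -- closure.
    refine he.exists_inv hx1 hx2 ?_ ?_ ?_ j m h
    · refine closure_minimal ?_ (isClosed_mul_left_eq e) hb
      rintro _ ⟨n, rfl⟩
      exact hp1 n
    · refine closure_minimal ?_ (isClosed_mul_right_eq e) hb
      rintro _ ⟨n, rfl⟩
      exact hp2 n
    · refine closure_minimal ?_ (isClosed_eq_of_mul x) hb
      rintro _ ⟨n, rfl⟩
      exact (powSucc_mul_comm x n).symm
  choose j h1 h2 h3 h4 using key
  refine ⟨j, hee, h1, h2, fun s => ?_, fun s => ?_⟩
  · have := h4 s
    rwa [mul_assoc, ← mul_assoc, h2] at this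
  · have := h3 s
    rwa [mul_assoc, h1, mul_assoc] at this

end Points

end SemigroupKernel

/-! ### Inversion is a morphism -/

/-- A surjective monomorphism of finite type to a reduced Noetherian scheme has a section over a
nonempty open subscheme. -/
theorem AlgebraicGeometry.exists_section_of_mono {H G : Scheme.{u}} (p : H ⟶ G) [Mono p]
    [LocallyOfFiniteType p] [QuasiCompact p] [Surjective p] [IsReduced G] [IsLocallyNoetherian G]
    [Nonempty G] : ∃ U : G.Opens, (U : Set G).Nonempty ∧ ∃ s : U.toScheme ⟶ H, s ≫ p = U.ι := by
  obtain ⟨x⟩ := ‹Nonempty G›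
  have hirr : IsIrreducible (irreducibleComponent x) := isIrreducible_irreducibleComponent
  have hη : closure {hirr.genericPoint} ∈ irreducibleComponents G := by
    rw [hirr.genericPoint_closure_eq, isClosed_irreducibleComponent.closure_eq]
    exact irreducibleComponent_mem_irreducibleComponents x
  set η := hirr.genericPoint
  -- Over the generic point of a component of a reduced scheme the base is a field, so the base
  -- change of `p` is flat, and a flat surjective monomorphism of this kind is an isomorphism. Its
  -- inverse spreads out to an open neighbourhood.
  have hfield := isField_stalk_of_closure_mem_irreducibleComponents G η hη
  let _ : Field (G.presheaf.stalk η) := hfield.toField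
  have hsub : Subsingleton (Spec (G.presheaf.stalk η)) :=
    inferInstanceAs (Subsingleton (PrimeSpectrum (G.presheaf.stalk η)))
  have hint : IsIntegral (Spec (G.presheaf.stalk η)) := inferInstance
  let p' := Limits.pullback.snd p (G.fromSpecStalk η)
  have : IsIso p' := Flat.isIso_of_surjective_of_mono p'
  obtain ⟨U, hU, s, -, hs⟩ := spread_out_of_isGermInjective' (𝟙 G) p (x := η)
    (inv p' ≫ Limits.pullback.fst p (G.fromSpecStalk η)) (by
      rw [Category.assoc, Limits.pullback.condition, Category.comp_id]
      exact IsIso.inv_hom_id_assoc p' _)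
  exact ⟨U, ⟨η, hU⟩, s, by rw [hs, Category.comp_id]⟩

/-- A monomorphism with sections over an open cover of the target has a section. -/
theorem AlgebraicGeometry.exists_section_of_openCover {H G : Scheme.{u}} (p : H ⟶ G) [Mono p]
    (𝒰 : G.OpenCover) (s : ∀ i, 𝒰.X i ⟶ H) (hs : ∀ i, s i ≫ p = 𝒰.f i) :
    ∃ t : G ⟶ H, t ≫ p = 𝟙 G := by
  refine ⟨𝒰.glueMorphisms s fun i j => ?_, ?_⟩
  -- Sections of a monomorphism are unique, so they agree on overlaps.
  · rw [← cancel_mono p, Category.assoc, Category.assoc, hs, hs, Limits.pullback.condition]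
  · refine Scheme.Cover.hom_ext 𝒰 _ _ fun i => ?_
    rw [Scheme.Cover.ι_glueMorphisms_assoc, hs, Category.comp_id]

section

variable {k : Type u} [Field k] [IsAlgClosed k] {G : Over (Spec (CommRingCat.of k))}

open scoped MonObj

/-- An algebraic monoid all of whose rational points are invertible is an algebraic group. -/
theorem exists_inv_of_isUnit [IsVariety G] [MonObj G]
    (hG : ∀ g : 𝟙_ (Over (Spec (CommRingCat.of k))) ⟶ G, ∃ h : 𝟙_ _ ⟶ G, g * h = 1 ∧ h * g = 1) :
    ∃ i : G ⟶ G, i * 𝟙 G = 1 ∧ 𝟙 G * i = 1 := by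
  -- The equalizer `H` is the scheme of pairs $(a,b)$ with $ab = ba = 1$, possibly non-reduced.
  -- Uniqueness of inverses makes its first projection a monomorphism; a section of it is an
  -- inversion.
  let f₁ : G ⊗ G ⟶ G ⊗ G := lift (fst G G * snd G G) (snd G G * fst G G)
  let f₂ : G ⊗ G ⟶ G ⊗ G := lift 1 1
  let H := Limits.equalizer f₁ f₂
  let j : H ⟶ G ⊗ G := Limits.equalizer.ι f₁ f₂
  let p : H ⟶ G := j ≫ fst G G
  let p₂ : H ⟶ G := j ≫ snd G G
  have hcond : p * p₂ = 1 ∧ p₂ * p = 1 := by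
    have := Limits.equalizer.condition f₁ f₂
    have h1 := congrArg (fun f => f ≫ fst G G) this
    have h2 := congrArg (fun f => f ≫ snd G G) this
    simp only [f₁, f₂, Category.assoc, lift_fst, lift_snd, MonObj.comp_mul, MonObj.comp_one] at h1 h2
    exact ⟨h1, h2⟩
  have hlift : ∀ {T : Over (Spec (CommRingCat.of k))} (a b : T ⟶ G), a * b = 1 → b * a = 1 →
      ∃ c : T ⟶ H, c ≫ p = a ∧ c ≫ p₂ = b := by
    intro T a b hab hba
    refine ⟨Limits.equalizer.lift (lift a b) ?_, ?_, ?_⟩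
    · simp only [f₁, f₂, comp_lift, MonObj.comp_mul, MonObj.comp_one, lift_fst, lift_snd, hab, hba]
    · simp only [p, j, Limits.equalizer.lift_ι_assoc, lift_fst]
    · simp only [p₂, j, Limits.equalizer.lift_ι_assoc, lift_snd]
  have hinv : ∀ {T : Over (Spec (CommRingCat.of k))} (c : T ⟶ H),
      (c ≫ p) * (c ≫ p₂) = 1 ∧ (c ≫ p₂) * (c ≫ p) = 1 := by
    intro T c
    constructor
    · rw [← MonObj.comp_mul c p p₂, hcond.1, MonObj.comp_one]
    · rw [← MonObj.comp_mul c p₂ p, hcond.2, MonObj.comp_one]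
  have hmono : Mono p := by
    refine ⟨fun {T} a b hab => ?_⟩
    have h2 : a ≫ p₂ = b ≫ p₂ := by
      refine left_inv_eq_right_inv (hinv a).2 ?_
      rw [hab, (hinv b).1]
    refine Limits.equalizer.hom_ext ?_
    refine CartesianMonoidalCategory.hom_ext _ _ ?_ ?_
    · simpa only [Category.assoc] using hab
    · simpa only [Category.assoc] using h2
  have hj : IsClosedImmersion j.left := inferInstance
  have hH1 : LocallyOfFiniteType H.hom := by rw [← Over.w j]; infer_instance
  have hH2 : QuasiCompact H.hom := by rw [← Over.w j]; infer_instance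
  have hnoeth := isNoetherian_left (X := G)
  have hnoeth' := isNoetherian_left (X := H)
  have : LocallyOfFiniteType p.left := by
    have : LocallyOfFiniteType (p.left ≫ G.hom) := by rw [Over.w]; infer_instance
    exact locallyOfFiniteType_of_comp _ G.hom
  have hmono' : Mono p.left := inferInstance
  have : Surjective p.left := surjective_left_of_surjective_map p fun g => by
    obtain ⟨h, h1, h2⟩ := hG g
    obtain ⟨c, hc, -⟩ := hlift _ _ h1 h2
    exact ⟨c, hc⟩
  have : Nonempty G.left := ⟨Pt.toScheme (X := G) (1 : 𝟙_ _ ⟶ G)⟩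
  obtain ⟨U, hU, s, hs⟩ := exists_section_of_mono p.left
  -- left translations
  let τ (g : 𝟙_ (Over (Spec (CommRingCat.of k))) ⟶ G) : G ⟶ G := (toUnit G ≫ g) * 𝟙 G
  have hτ : ∀ g h, h * g = 1 → τ g ≫ τ h = 𝟙 G := by
    intro g h hgh
    have hu : τ g ≫ toUnit G ≫ h = toUnit G ≫ h := by
      rw [← Category.assoc, toUnit_unique (τ g ≫ toUnit G) (toUnit G)]
    change τ g ≫ ((toUnit G ≫ h) * 𝟙 G) = 𝟙 G
    rw [MonObj.comp_mul, hu, Category.comp_id, ← mul_assoc, ← MonObj.comp_mul, hgh,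
      MonObj.comp_one, one_mul]
  -- Left translation by $g$ lifts to $(a,b) \mapsto (ga, bg^{-1})$.
  have hσ : ∀ g, ∃ σ : H ⟶ H, σ ≫ p = p ≫ τ g := by
    intro g
    obtain ⟨h, h1, h2⟩ := hG g
    obtain ⟨c, hc, -⟩ := hlift ((toUnit H ≫ g) * p) (p₂ * (toUnit H ≫ h))
      (by rw [mul_assoc, ← mul_assoc p, hcond.1, one_mul, ← MonObj.comp_mul, h1, MonObj.comp_one])
      (by rw [mul_assoc, ← mul_assoc (toUnit H ≫ h), ← MonObj.comp_mul, h2, MonObj.comp_one,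
        one_mul, hcond.2])
    refine ⟨c, hc.trans ?_⟩
    rw [MonObj.comp_mul, Category.comp_id, ← Category.assoc,
      toUnit_unique (p ≫ toUnit G) (toUnit H)]
  choose σ hσ using hσ
  have hiso : ∀ g, IsIso (τ g) := by
    intro g
    obtain ⟨h, h1, h2⟩ := hG g
    exact ⟨τ h, hτ g h h2, hτ h g h1⟩
  have hiso' : ∀ g, IsIso (τ g).left := fun g => (Over.forget _).map_isIso (τ g)
  -- For a rational point $u$ of $U$, translation by $qu^{-1}$ carries $u$ to $q$. An uncovered
  -- point would give an uncovered closed point.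
  have hcover : ∀ x : G.left, ∃ g, x ∈ Set.range (U.ι ≫ (τ g).left) := by
    have hjac := jacobsonSpace_left (X := G)
    obtain ⟨_, hu1, hu2⟩ := nonempty_inter_closedPoints hU U.isOpen.isLocallyClosed
    obtain ⟨u, rfl⟩ := Pt.exists_toScheme_eq hu2
    obtain ⟨v, -, hvu⟩ := hG u
    by_contra! hx
    obtain ⟨x, hx⟩ := hx
    have hopen : IsOpen (⋃ g, Set.range (U.ι ≫ (τ g).left)) :=
      isOpen_iUnion fun g => (U.ι ≫ (τ g).left).isOpenEmbedding.isOpen_range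
    obtain ⟨_, hq1, hq2⟩ := nonempty_inter_closedPoints
      (Z := (⋃ g, Set.range (U.ι ≫ (τ g).left))ᶜ) ⟨x, by simpa using hx⟩
      hopen.isClosed_compl.isLocallyClosed
    obtain ⟨q, rfl⟩ := Pt.exists_toScheme_eq hq2
    refine hq1 (Set.mem_iUnion.2 ⟨(show 𝟙_ _ ⟶ G from q) * v, ⟨u.toScheme, hu1⟩, ?_⟩)
    change (τ _).left u.toScheme = _
    rw [← Pt.toScheme_map]
    congr 1
    change (show 𝟙_ _ ⟶ G from u) ≫ (_ * 𝟙 G) = (show 𝟙_ _ ⟶ G from q)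
    rw [MonObj.comp_mul, Category.comp_id, ← Category.assoc,
      toUnit_unique ((show 𝟙_ _ ⟶ G from u) ≫ toUnit G) (𝟙 _), Category.id_comp, mul_assoc]
    exact (congrArg _ hvu).trans (mul_one _)
  let 𝒰 : G.left.OpenCover := Scheme.Cover.mkOfCovers
    (𝟙_ (Over (Spec (CommRingCat.of k))) ⟶ G) (fun _ => U.toScheme)
    (fun g => U.ι ≫ (τ g).left) (fun x => by
      obtain ⟨g, y, hy⟩ := hcover x
      exact ⟨g, y, hy⟩) (fun g => inferInstance)
  obtain ⟨t, ht⟩ := exists_section_of_openCover p.left 𝒰 (fun g => s ≫ (σ g).left) (by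
    suffices h : ∀ g, (s ≫ (σ g).left) ≫ p.left = U.ι ≫ (τ g).left from h
    intro g
    rw [Category.assoc, ← Over.comp_left, hσ, Over.comp_left, reassoc_of% hs])
  let t' : G ⟶ H := Over.homMk t (by
    rw [← Over.w p, reassoc_of% ht])
  have ht' : t' ≫ p = 𝟙 G := Over.OverMorphism.ext ht
  refine ⟨t' ≫ p₂, ?_, ?_⟩
  · rw [← ht', (hinv t').2]
  · rw [← ht', (hinv t').1]

end

/-! ### Semigroups of $T$-valued points -/

section HomSemigroup

universe v w

variable {C : Type w} [Category.{v} C] [CartesianMonoidalCategory C] {S : C} [SemigroupObj S]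

/-- The semigroup of `T`-valued points of a semigroup object. -/
@[reducible] def SemigroupObj.homSemigroup (T : C) : Semigroup (T ⟶ S) where
  mul f g := lift f g ≫ SemigroupObj.mul
  mul_assoc f g h := by
    suffices H : lift (lift f g ≫ SemigroupObj.mul) h ≫ SemigroupObj.mul =
        lift f (lift g h ≫ SemigroupObj.mul) ≫ SemigroupObj.mul from H
    have := congrArg (fun u => lift (lift f g) h ≫ u) (SemigroupObj.assoc (X := S))
    simpa [lift_whiskerRight_assoc, lift_lift_associator_hom_assoc,
      lift_whiskerLeft_assoc] using this

attribute [local instance] SemigroupObj.homSemigroup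

theorem SemigroupObj.hom_mul_def {T : C} (f g : T ⟶ S) : f * g = lift f g ≫ SemigroupObj.mul := rfl

theorem SemigroupObj.comp_mul {T T' : C} (h : T' ⟶ T) (f g : T ⟶ S) :
    h ≫ (f * g) = (h ≫ f) * (h ≫ g) := by
  rw [hom_mul_def, hom_mul_def, ← Category.assoc, comp_lift]

variable {V : C} (i : V ⟶ S) (m : V ⊗ V ⟶ V)

theorem SemigroupObj.lift_comp_of_restricts (hm : m ≫ i = (fst V V ≫ i) * (snd V V ≫ i)) {T : C}
    (a b : T ⟶ V) : lift a b ≫ m ≫ i = (a ≫ i) * (b ≫ i) := by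
  rw [hm, comp_mul, lift_fst_assoc, lift_snd_assoc]

/-- The restriction of an associative law to a subobject is associative. -/
theorem SemigroupObj.assoc_of_restricts [Mono i]
    (hm : m ≫ i = (fst V V ≫ i) * (snd V V ≫ i)) :
    (m ▷ V) ≫ m = (α_ V V V).hom ≫ (V ◁ m) ≫ m := by
  rw [← cancel_mono i]
  simp only [Category.assoc, hm, comp_mul, whiskerRight_fst_assoc, whiskerRight_snd_assoc,
    whiskerLeft_fst_assoc, whiskerLeft_snd_assoc, associator_hom_fst_assoc,
    associator_hom_snd_fst_assoc, associator_hom_snd_snd_assoc, mul_assoc]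

/-- The structure of a semigroup object on a subobject stable under the law. -/
@[reducible] def SemigroupObj.restrict [Mono i] (hm : m ≫ i = (fst V V ≫ i) * (snd V V ≫ i)) :
    SemigroupObj V where
  mul := m
  assoc := assoc_of_restricts i m hm

end HomSemigroup

/-! ### The group $eSe$ and the morphism $s \mapsto (ese)^{-1}$ -/

section Inversion

attribute [local instance] SemigroupObj.homSemigroup

open SemigroupKernel

variable {k : Type u} [Field k] {S : Over (Spec (CommRingCat.of k))} [SemigroupObj S]

theorem Pt.map_mul {X : Over (Spec (CommRingCat.of k))} (f g : X ⟶ S) (p : Pt X) :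
    Pt.map (f * g) p = Pt.map f p * Pt.map g p :=
  SemigroupObj.comp_mul (show 𝟙_ (Over (Spec (CommRingCat.of k))) ⟶ X from p) f g

omit [SemigroupObj S] in
theorem Pt.comp_const {X Y : Over (Spec (CommRingCat.of k))} (f : X ⟶ Y) (e : Pt S) :
    f ≫ Pt.const Y e = Pt.const X e := by
  rw [Pt.const, Pt.const, ← Category.assoc, toUnit_unique (f ≫ toUnit Y) (toUnit X)]

omit [SemigroupObj S] in
theorem Pt.const_unit (e : Pt S) : Pt.const (𝟙_ _) e = e := by
  rw [Pt.const, toUnit_unique (toUnit (𝟙_ (Over (Spec (CommRingCat.of k))))) (𝟙 _)]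
  exact Category.id_comp _

/-- A morphism `ι : S ⟶ S` computing the inverse of `e s e` in `eSe`, functorially. -/
def IsInversion (e : Pt S) (ι : S ⟶ S) : Prop :=
  ∀ T : Over (Spec (CommRingCat.of k)), IsCornerInversion (Pt.const T e) (fun f : T ⟶ S => f ≫ ι)

theorem IsInversion.pt {e : Pt S} {ι : S ⟶ S} (h : IsInversion e ι) :
    IsCornerInversion e (Pt.map ι) := by
  have := h (𝟙_ _)
  rw [Pt.const_unit] at this
  exact ⟨this.1, this.2, this.3, this.4, this.5⟩

variable [IsAlgClosed k]

theorem exists_corner_retraction [IsVariety S] {e : Pt S} {j : Pt S → Pt S}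
    (h : IsCornerInversion e j) : IsClosed (corner e) ∧ ∃ q : S ⟶ cornerVar e,
      q ≫ closedSubvariety.incl (corner e) = Pt.const S e * (𝟙 S * Pt.const S e) ∧
      closedSubvariety.incl (corner e) ≫ q = 𝟙 _ := by
  have hee : Pt.const S e * Pt.const S e = Pt.const S e := by
    rw [Pt.const, ← SemigroupObj.comp_mul]
    exact congrArg _ h.idem
  refine exists_retraction _ ?_ _ fun p => ?_
  · simp only [SemigroupObj.comp_mul, Pt.comp_const, Category.comp_id, mul_assoc, hee]
    simp only [← mul_assoc, hee]
  · rw [h.corner_iff, Pt.map_mul, Pt.map_mul, Pt.map_const, Pt.map_id]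

/-- The group structure on `eSe`, and the inversion morphism of `S`. -/
theorem exists_grpObj_corner [IsVariety S] {e : Pt S} {j : Pt S → Pt S}
    (h : IsCornerInversion e j) :
    ∃ (_ : GrpObj (cornerVar e)) (ι : S ⟶ S), IsInversion e ι ∧
      Pt.map (closedSubvariety.incl (corner e)) MonObj.one = e ∧
      MonObj.mul ≫ closedSubvariety.incl (corner e) =
        (fst (cornerVar e) (cornerVar e) ≫ closedSubvariety.incl (corner e)) *
          (snd (cornerVar e) (cornerVar e) ≫ closedSubvariety.incl (corner e)) ∧
      GrpObj.inv ≫ closedSubvariety.incl (corner e) =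
        closedSubvariety.incl (corner e) ≫ ι := by
  obtain ⟨hcl, q, hq, hq'⟩ := exists_corner_retraction h
  set i := closedSubvariety.incl (corner e) with hi
  have hee : ∀ T, Pt.const T e * Pt.const T e = Pt.const T e := fun T => by
    rw [Pt.const, ← SemigroupObj.comp_mul]
    exact congrArg _ h.idem
  have hqi : ∀ {T : Over (Spec (CommRingCat.of k))} (f : T ⟶ S),
      f ≫ q ≫ i = Pt.const T e * (f * Pt.const T e) := fun f => by
    rw [hq, SemigroupObj.comp_mul, SemigroupObj.comp_mul, Pt.comp_const, Category.comp_id]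
  have hfix : ∀ {T : Over (Spec (CommRingCat.of k))} (a : T ⟶ cornerVar e),
      Pt.const T e * (a ≫ i) = a ≫ i ∧ (a ≫ i) * Pt.const T e = a ≫ i := fun {T} a => by
    have h1 := hqi (a ≫ i)
    rw [Category.assoc, reassoc_of% hq'] at h1
    constructor
    · rw [h1, ← mul_assoc, hee]
    · rw [h1]; simp only [mul_assoc, hee]
  have hone : (show 𝟙_ _ ⟶ S from e) ≫ q ≫ i = e := by
    rw [hqi, Pt.const_unit]
    change e * (e * e) = e
    rw [h.idem, h.idem]
  let m : cornerVar e ⊗ cornerVar e ⟶ cornerVar e := ((fst _ _ ≫ i) * (snd _ _ ≫ i)) ≫ q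
  -- The retraction `q` only serves to land in $eSe$; it does not alter a product of elements of
  -- $eSe$.
  have hm : m ≫ i = (fst _ _ ≫ i) * (snd _ _ ≫ i) := by
    rw [Category.assoc, hqi, mul_assoc, (hfix _).2, ← mul_assoc, (hfix _).1]
  let _ : MonObj (cornerVar e) :=
    { one := (show 𝟙_ _ ⟶ S from e) ≫ q
      mul := m
      mul_assoc := SemigroupObj.assoc_of_restricts i m hm
      one_mul := by
        rw [← cancel_mono i, Category.assoc, hm, SemigroupObj.comp_mul,
          whiskerRight_fst_assoc, whiskerRight_snd_assoc, Category.assoc, hone,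
          leftUnitor_hom, toUnit_unique (fst (𝟙_ _) (cornerVar e)) (toUnit _)]
        exact (hfix _).1
      mul_one := by
        rw [← cancel_mono i, Category.assoc, hm, SemigroupObj.comp_mul,
          whiskerLeft_fst_assoc, whiskerLeft_snd_assoc, Category.assoc, hone,
          rightUnitor_hom, toUnit_unique (snd (cornerVar e) (𝟙_ _)) (toUnit _)]
        exact (hfix _).2 }
  have hmul : ∀ {T : Over (Spec (CommRingCat.of k))} (a b : T ⟶ cornerVar e),
      (lift a b ≫ MonObj.mul) ≫ i = (a ≫ i) * (b ≫ i) := fun a b => by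
    rw [Category.assoc]
    exact SemigroupObj.lift_comp_of_restricts i m hm a b
  have hunit : ∀ T : Over (Spec (CommRingCat.of k)),
      (toUnit T ≫ MonObj.one (X := cornerVar e)) ≫ i = Pt.const T e := fun T => by
    exact (Category.assoc _ _ _).trans (congrArg (fun f => toUnit T ≫ f) hone)
  obtain ⟨inv, hinv1, hinv2⟩ := exists_inv_of_isUnit (G := cornerVar e) (fun g => by
    have hg := hfix g
    rw [Pt.const_unit] at hg
    have hg1 : e * Pt.map i g = Pt.map i g := hg.1
    have hg2 : Pt.map i g * e = Pt.map i g := hg.2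
    obtain ⟨t, ht⟩ : ∃ t : 𝟙_ _ ⟶ cornerVar e, t ≫ i = j (Pt.map i g) := by
      refine ⟨(show 𝟙_ _ ⟶ S from j (Pt.map i g)) ≫ q, ?_⟩
      rw [Category.assoc, hqi, Pt.const_unit]
      change e * (j (Pt.map i g) * e) = _
      rw [h.right, h.left]
    have h1 : Pt.map i g * j (Pt.map i g) = e := by
      have := h.inv_right (Pt.map i g)
      rwa [← mul_assoc, hg1] at this
    have h2 : j (Pt.map i g) * Pt.map i g = e := by
      have := h.inv_left (Pt.map i g)
      rwa [hg2] at this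
    refine ⟨t, ?_, ?_⟩
    · refine (cancel_mono i).1 ((hmul g t).trans ?_)
      rw [ht]
      exact h1.trans ((Pt.const_unit e).symm.trans (hunit _).symm)
    · refine (cancel_mono i).1 ((hmul t g).trans ?_)
      rw [ht]
      exact h2.trans ((Pt.const_unit e).symm.trans (hunit _).symm))
  have hinv1' : lift inv (𝟙 _) ≫ MonObj.mul = toUnit (cornerVar e) ≫ MonObj.one := hinv1
  have hinv2' : lift (𝟙 _) inv ≫ MonObj.mul = toUnit (cornerVar e) ≫ MonObj.one := hinv2
  have hinv : ∀ {T : Over (Spec (CommRingCat.of k))} (a : T ⟶ cornerVar e),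
      ((a ≫ inv) ≫ i) * (a ≫ i) = Pt.const T e ∧ (a ≫ i) * ((a ≫ inv) ≫ i) = Pt.const T e := by
    intro T a
    constructor
    · rw [← hmul, ← hunit, ← toUnit_unique (a ≫ toUnit _) (toUnit T), Category.assoc a, ← hinv1',
        ← Category.assoc a, comp_lift, Category.comp_id]
    · rw [← hmul, ← hunit, ← toUnit_unique (a ≫ toUnit _) (toUnit T), Category.assoc a, ← hinv2',
        ← Category.assoc a, comp_lift, Category.comp_id]
  -- `ι` retracts $s$ to $ese$, inverts there and includes back in $S$.
  refine ⟨{ inv := inv, left_inv := hinv1', right_inv := hinv2' }, q ≫ inv ≫ i, ?_, hone, hm, ?_⟩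
  · intro T
    refine ⟨hee T, fun f => ?_, fun f => ?_, fun f => ?_, fun f => ?_⟩
    · simpa only [Category.assoc] using (hfix (f ≫ q ≫ inv)).1
    · simpa only [Category.assoc] using (hfix (f ≫ q ≫ inv)).2
    · have h1 := (hinv (f ≫ q)).1
      have h2 := (hfix (f ≫ q ≫ inv)).2
      simp only [Category.assoc, hqi] at h1 h2 ⊢
      rw [← mul_assoc, h2] at h1
      exact h1
    · have h1 := (hinv (f ≫ q)).2
      have h2 := (hfix (f ≫ q ≫ inv)).1
      simp only [Category.assoc, hqi] at h1 h2 ⊢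
      rw [mul_assoc, mul_assoc, h2] at h1
      exact h1
  · rw [reassoc_of% hq']
    rfl

end Inversion

/-! ### The subvarieties as retracts representing subfunctors -/

section Represented

variable {k : Type u} [Field k] {S : Over (Spec (CommRingCat.of k))}

/-- `A` is closed in `S`, and the closed subvariety `A` is a retract of `S` that represents the
family of sets `B T` of `T`-valued points of `S`. -/
structure IsRetract (A : Set (Pt S)) (B : ∀ T : Over (Spec (CommRingCat.of k)), Set (T ⟶ S))
    (r : S ⟶ S) (q : S ⟶ closedSubvariety A) : Prop where
  isClosed : IsClosed A
  comp_incl : q ≫ closedSubvariety.incl A = r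
  incl_comp : closedSubvariety.incl A ≫ q = 𝟙 _
  mem_iff : ∀ {T} (f : T ⟶ S), f ∈ B T ↔ f ≫ r = f

namespace IsRetract

variable {A : Set (Pt S)} {B : ∀ T : Over (Spec (CommRingCat.of k)), Set (T ⟶ S)}
    {r : S ⟶ S} {q : S ⟶ closedSubvariety A} (h : IsRetract A B r q)
include h

theorem mem {T : Over (Spec (CommRingCat.of k))} (a : T ⟶ closedSubvariety A) :
    a ≫ closedSubvariety.incl A ∈ B T := by
  rw [h.mem_iff, ← h.comp_incl, Category.assoc, reassoc_of% h.incl_comp]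

theorem lift_incl {T : Over (Spec (CommRingCat.of k))} {f : T ⟶ S} (hf : f ∈ B T) :
    f ≫ q ≫ closedSubvariety.incl A = f := by
  rw [h.comp_incl, (h.mem_iff f).1 hf]

end IsRetract

end Represented

section Retracts

attribute [local instance] SemigroupObj.homSemigroup

open SemigroupKernel

variable {k : Type u} [Field k] [IsAlgClosed k] {S : Over (Spec (CommRingCat.of k))}
  [SemigroupObj S] [IsVariety S] {e : Pt S} {ι : S ⟶ S}

namespace IsInversion

variable (h : IsInversion e ι)
include h

/-- The fixed-point criterion is used twice: on rational points for closedness and the retraction,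
on $T$-valued points for the functorial description. The next four lemmas follow the same pattern.
-/
theorem exists_isRetract_corner : ∃ q, IsRetract (corner e) (fun T => corner (Pt.const T e))
    (Pt.const S e * (𝟙 S * Pt.const S e)) q := by
  obtain ⟨h1, q, h2, h3⟩ := exists_corner_retraction h.pt
  refine ⟨q, h1, h2, h3, fun {T} f => ?_⟩
  rw [(h T).corner_iff]
  simp only [SemigroupObj.comp_mul, Pt.comp_const, Category.comp_id]

theorem exists_isRetract_left : ∃ q, IsRetract (leftFiber e)
    (fun T => leftFiber (Pt.const T e)) (𝟙 S * ι) q := by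
  obtain ⟨h1, q, h2, h3⟩ := exists_retraction (𝟙 S * ι) (by
    have := (h S).leftRetract_idem (𝟙 S)
    simpa only [SemigroupObj.comp_mul, Category.comp_id, Category.id_comp] using this)
    (leftFiber e) (fun p => by rw [h.pt.leftFiber_iff, Pt.map_mul, Pt.map_id])
  refine ⟨q, h1, h2, h3, fun {T} f => ?_⟩
  rw [(h T).leftFiber_iff]
  simp only [SemigroupObj.comp_mul, Category.comp_id]

theorem exists_isRetract_right : ∃ q, IsRetract (rightFiber e)
    (fun T => rightFiber (Pt.const T e)) (ι * 𝟙 S) q := by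
  obtain ⟨h1, q, h2, h3⟩ := exists_retraction (ι * 𝟙 S) (by
    have := (h S).rightRetract_idem (𝟙 S)
    simpa only [SemigroupObj.comp_mul, Category.comp_id, Category.id_comp] using this)
    (rightFiber e) (fun p => by rw [h.pt.rightFiber_iff, Pt.map_mul, Pt.map_id])
  refine ⟨q, h1, h2, h3, fun {T} f => ?_⟩
  rw [(h T).rightFiber_iff]
  simp only [SemigroupObj.comp_mul, Category.comp_id]

theorem exists_isRetract_twoSided : ∃ q, IsRetract (twoSided e : Set (Pt S))
    (fun T => (twoSided (Pt.const T e) : Set (T ⟶ S))) (𝟙 S * (ι * 𝟙 S)) q := by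
  obtain ⟨h1, q, h2, h3⟩ := exists_retraction (𝟙 S * (ι * 𝟙 S)) (by
    have := (h S).twoSidedRetract_idem (𝟙 S)
    simpa only [SemigroupObj.comp_mul, Category.comp_id, Category.id_comp] using this)
    (twoSided e : Set (Pt S))
    (fun p => by rw [SetLike.mem_coe, h.pt.twoSided_iff, Pt.map_mul, Pt.map_mul, Pt.map_id])
  refine ⟨q, h1, h2, h3, fun {T} f => ?_⟩
  rw [SetLike.mem_coe, (h T).twoSided_iff]
  simp only [SemigroupObj.comp_mul, Category.comp_id]

theorem exists_isRetract_idempotents : ∃ q, IsRetract (idempotents e)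
    (fun T => {f | f ∈ twoSided (Pt.const T e) ∧ IsIdempotentElem f})
    (idemRetract (fun f : S ⟶ S => f ≫ ι) (𝟙 S)) q := by
  have hcomp : ∀ {T : Over (Spec (CommRingCat.of k))} (f : T ⟶ S),
      f ≫ idemRetract (fun f : S ⟶ S => f ≫ ι) (𝟙 S) = idemRetract (fun f => f ≫ ι) f := by
    intro T f
    simp only [idemRetract, SemigroupObj.comp_mul, Category.comp_id, ← Category.assoc]
  obtain ⟨h1, q, h2, h3⟩ := exists_retraction (idemRetract (fun f : S ⟶ S => f ≫ ι) (𝟙 S)) (by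
    rw [hcomp]
    exact (h S).idemRetract_idem (𝟙 S))
    (idempotents e) (fun p => by
      have := h.pt.idempotent_iff (x := p)
      refine this.trans (Eq.congr_left ?_)
      exact (hcomp p).symm)
  refine ⟨q, h1, h2, h3, fun {T} f => ?_⟩
  rw [hcomp]
  exact (h T).idempotent_iff

end IsInversion

/-! ### Product decompositions of $SeS$ and $E(SeS)$ -/

section Isomorphisms

variable (h : IsInversion e ι)
include h

/-- The isomorphism `ₑSe × eSe × eSₑ ≅ SeS`, `(x, g, y) ↦ x g y`. -/
theorem IsInversion.exists_tripleIso : ∃ Φ : leftVar e ⊗ (cornerVar e ⊗ rightVar e) ≅ twoSidedVar e,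
    Φ.hom ≫ closedSubvariety.incl (twoSided e : Set (Pt S)) =
      (fst _ _ ≫ closedSubvariety.incl (leftFiber e)) *
        ((snd _ _ ≫ fst _ _ ≫ closedSubvariety.incl (corner e)) *
          (snd _ _ ≫ snd _ _ ≫ closedSubvariety.incl (rightFiber e))) := by
  obtain ⟨qG, hG⟩ := h.exists_isRetract_corner
  obtain ⟨qL, hL⟩ := h.exists_isRetract_left
  obtain ⟨qR, hR⟩ := h.exists_isRetract_right
  obtain ⟨qK, hK⟩ := h.exists_isRetract_twoSided
  set T := leftVar e ⊗ (cornerVar e ⊗ rightVar e)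
  -- `x`, `g`, `y` are the universal components, so an identity between them in the semigroup `T ⟶
  -- S` is an identity of morphisms.
  let x : T ⟶ S := fst _ _ ≫ closedSubvariety.incl (leftFiber e)
  let g : T ⟶ S := snd _ _ ≫ fst _ _ ≫ closedSubvariety.incl (corner e)
  let y : T ⟶ S := snd _ _ ≫ snd _ _ ≫ closedSubvariety.incl (rightFiber e)
  have hx : x ∈ leftFiber (Pt.const T e) := hL.mem _
  have hg : g ∈ corner (Pt.const T e) := by
    simpa only [g, Category.assoc] using hG.mem (snd _ _ ≫ fst _ _ : T ⟶ cornerVar e)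
  have hy : y ∈ rightFiber (Pt.const T e) := by
    simpa only [y, Category.assoc] using hR.mem (snd _ _ ≫ snd _ _ : T ⟶ rightVar e)
  have hxgy : (x * (g * y)) ≫ qK ≫ closedSubvariety.incl (twoSided e : Set (Pt S)) =
      x * (g * y) := hK.lift_incl (IsCornerInversion.triple_mem hx)
  let iK := closedSubvariety.incl (twoSided e : Set (Pt S))
  refine ⟨{ hom := (x * (g * y)) ≫ qK
            inv := lift (iK ≫ qL) (lift (iK ≫ qG) (iK ≫ qR))
            hom_inv_id := ?_
            inv_hom_id := ?_ }, ?_⟩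
  · refine CartesianMonoidalCategory.hom_ext _ _ ?_ (CartesianMonoidalCategory.hom_ext _ _ ?_ ?_)
    · rw [← cancel_mono (closedSubvariety.incl (leftFiber e))]
      simp only [Category.assoc, lift_fst_assoc, Category.id_comp, hL.comp_incl, iK]
      rw [reassoc_of% hxgy, SemigroupObj.comp_mul, Category.comp_id]
      exact (h T).triple_left hx hg hy
    · rw [← cancel_mono (closedSubvariety.incl (corner e))]
      simp only [Category.assoc, lift_snd_assoc, lift_fst_assoc, Category.id_comp, hG.comp_incl, iK]
      rw [reassoc_of% hxgy, SemigroupObj.comp_mul, SemigroupObj.comp_mul, Category.comp_id,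
        Pt.comp_const]
      exact (h T).triple_corner hx hg hy
    · rw [← cancel_mono (closedSubvariety.incl (rightFiber e))]
      simp only [Category.assoc, lift_snd_assoc, Category.id_comp, hR.comp_incl, iK]
      rw [reassoc_of% hxgy, SemigroupObj.comp_mul, Category.comp_id]
      exact (h T).triple_right hx hg hy
  · rw [← cancel_mono iK, Category.assoc, Category.assoc, hxgy, SemigroupObj.comp_mul,
      SemigroupObj.comp_mul]
    simp only [x, g, y, lift_snd_assoc, lift_fst_assoc, Category.assoc, hL.comp_incl, hG.comp_incl,
      hR.comp_incl, SemigroupObj.comp_mul, Category.comp_id, Category.id_comp, Pt.comp_const]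
    have hmem := hK.mem (𝟙 _)
    rw [Category.id_comp] at hmem
    exact (h _).eq_triple hmem
  · rw [Category.assoc, hxgy]

/-- The isomorphism `ₑSe × eSₑ ≅ E(SeS)`, `(x, y) ↦ x (y x)⁻¹ y`. -/
theorem IsInversion.exists_idempotentIso : ∃ Ψ : leftVar e ⊗ rightVar e ≅ idempotentVar e,
    Ψ.hom ≫ closedSubvariety.incl (idempotents e) =
      (fst _ _ ≫ closedSubvariety.incl (leftFiber e)) *
        ((((snd _ _ ≫ closedSubvariety.incl (rightFiber e)) *
          (fst _ _ ≫ closedSubvariety.incl (leftFiber e))) ≫ ι) *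
          (snd _ _ ≫ closedSubvariety.incl (rightFiber e))) := by
  obtain ⟨qL, hL⟩ := h.exists_isRetract_left
  obtain ⟨qR, hR⟩ := h.exists_isRetract_right
  obtain ⟨qE, hE⟩ := h.exists_isRetract_idempotents
  set T := leftVar e ⊗ rightVar e
  let x : T ⟶ S := fst _ _ ≫ closedSubvariety.incl (leftFiber e)
  let y : T ⟶ S := snd _ _ ≫ closedSubvariety.incl (rightFiber e)
  have hx : x ∈ leftFiber (Pt.const T e) := hL.mem _
  have hy : y ∈ rightFiber (Pt.const T e) := hR.mem _
  have hg : (y * x) ≫ ι ∈ corner (Pt.const T e) := (h T).inv_mem_corner _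
  have hxy : (x * (((y * x) ≫ ι) * y)) ≫ qE ≫ closedSubvariety.incl (idempotents e) =
      x * (((y * x) ≫ ι) * y) := hE.lift_incl ((h T).idemRetract_mem hx hy)
  let iE := closedSubvariety.incl (idempotents e)
  -- The inverse keeps the outer components $s\,\iota(s)$ and $\iota(s)\,s$; for an idempotent the
  -- middle one is redundant.
  refine ⟨{ hom := (x * (((y * x) ≫ ι) * y)) ≫ qE
            inv := lift (iE ≫ qL) (iE ≫ qR)
            hom_inv_id := ?_
            inv_hom_id := ?_ }, ?_⟩
  · refine CartesianMonoidalCategory.hom_ext _ _ ?_ ?_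
    · rw [← cancel_mono (closedSubvariety.incl (leftFiber e))]
      simp only [Category.assoc, lift_fst_assoc, Category.id_comp, hL.comp_incl, iE]
      rw [reassoc_of% hxy, SemigroupObj.comp_mul, Category.comp_id]
      exact (h T).triple_left hx hg hy
    · rw [← cancel_mono (closedSubvariety.incl (rightFiber e))]
      simp only [Category.assoc, lift_snd_assoc, Category.id_comp, hR.comp_incl, iE]
      rw [reassoc_of% hxy, SemigroupObj.comp_mul, Category.comp_id]
      exact (h T).triple_right hx hg hy
  · have hmem := hE.mem (𝟙 _)
    rw [Category.id_comp] at hmem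
    have hmem' := (h _).idempotent_iff.1 hmem
    have hux : lift (iE ≫ qL) (iE ≫ qR) ≫ x = iE * (iE ≫ ι) := by
      simp only [x, lift_fst_assoc, Category.assoc, hL.comp_incl, SemigroupObj.comp_mul,
        Category.comp_id]
    have huy : lift (iE ≫ qL) (iE ≫ qR) ≫ y = (iE ≫ ι) * iE := by
      simp only [y, lift_snd_assoc, Category.assoc, hR.comp_incl, SemigroupObj.comp_mul,
        Category.comp_id]
    rw [← cancel_mono iE, Category.assoc, Category.assoc, hxy, SemigroupObj.comp_mul,
      SemigroupObj.comp_mul, ← Category.assoc _ (y * x), SemigroupObj.comp_mul, hux, huy,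
      Category.id_comp]
    rw [idemRetract] at hmem'
    simpa only [mul_assoc] using hmem'
  · rw [Category.assoc, hxy]

end Isomorphisms

end Retracts

/-! ### Pairing, law and retraction of $SeS$ -/

section Consequences

attribute [local instance] SemigroupObj.homSemigroup

open SemigroupKernel

variable {k : Type u} [Field k] {S : Over (Spec (CommRingCat.of k))} [SemigroupObj S]

theorem Pt.map_mul_of_restricts {V : Over (Spec (CommRingCat.of k))} [SemigroupObj V] (i : V ⟶ S)
    (hm : SemigroupObj.mul ≫ i = (fst V V ≫ i) * (snd V V ≫ i)) (a b : Pt V) :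
    Pt.map i (a * b) = Pt.map i a * Pt.map i b := by
  rw [Pt.mul_def, ← Pt.map_comp, hm, Pt.map_mul, Pt.map_comp, Pt.map_comp, Pt.map_fst_pair,
    Pt.map_snd_pair]

variable [IsAlgClosed k] [IsVariety S] {e : Pt S} {ι : S ⟶ S} (h : IsInversion e ι)
include h

/-- The morphism `eSₑ × ₑSe ⟶ eSe`, `(y, z) ↦ y z`. -/
theorem IsInversion.exists_pairing : ∃ π : rightVar e ⊗ leftVar e ⟶ cornerVar e,
    π ≫ closedSubvariety.incl (corner e) =
      (fst _ _ ≫ closedSubvariety.incl (rightFiber e)) *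
        (snd _ _ ≫ closedSubvariety.incl (leftFiber e)) := by
  obtain ⟨qG, hG⟩ := h.exists_isRetract_corner
  obtain ⟨qL, hL⟩ := h.exists_isRetract_left
  obtain ⟨qR, hR⟩ := h.exists_isRetract_right
  have hy := hR.mem (fst (rightVar e) (leftVar e))
  have hz := hL.mem (snd (rightVar e) (leftVar e))
  refine ⟨((fst _ _ ≫ closedSubvariety.incl (rightFiber e)) *
        (snd _ _ ≫ closedSubvariety.incl (leftFiber e))) ≫ qG, ?_⟩
  rw [Category.assoc]
  refine hG.lift_incl ((h _).corner_iff.2 ?_)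
  rw [mul_assoc, hz.1, ← mul_assoc, hy.1]

/-- The law of `S` restricts to `SeS`. -/
theorem IsInversion.exists_twoSided_mul : ∃ m : twoSidedVar e ⊗ twoSidedVar e ⟶ twoSidedVar e,
    m ≫ closedSubvariety.incl (twoSided e : Set (Pt S)) =
      (fst _ _ ≫ closedSubvariety.incl (twoSided e : Set (Pt S))) *
        (snd _ _ ≫ closedSubvariety.incl (twoSided e : Set (Pt S))) := by
  obtain ⟨qK, hK⟩ := h.exists_isRetract_twoSided
  refine ⟨_ ≫ qK, (Category.assoc _ _ _).trans (hK.lift_incl ?_)⟩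
  exact (twoSided _).mul_mem (hK.mem (fst (twoSidedVar e) (twoSidedVar e)))
    (hK.mem (snd (twoSidedVar e) (twoSidedVar e)))

omit [IsAlgClosed k] [IsVariety S] in
theorem IsInversion.cornerInv_mul {x y : Pt S} (hx : x ∈ leftFiber e) (hy : y ∈ rightFiber e) :
    cornerInv e (y * x) = Pt.map ι (y * x) :=
  h.pt.cornerInv_eq rfl (by rw [mul_assoc, mul_assoc, hx.1, ← mul_assoc, hy.1])

theorem IsInversion.exists_retraction_twoSided : ∃ ρ : S ⟶ twoSidedVar e,
    closedSubvariety.incl (twoSided e : Set (Pt S)) ≫ ρ = 𝟙 (twoSidedVar e) ∧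
      ∀ s : Pt S, (Pt.map ρ s).incl = s * cornerInv e (e * s * e) * s := by
  obtain ⟨qK, hK⟩ := h.exists_isRetract_twoSided
  refine ⟨qK, hK.incl_comp, fun s => ?_⟩
  rw [Pt.incl, ← Pt.map_comp, hK.comp_incl, Pt.map_mul, Pt.map_mul, Pt.map_id,
    h.pt.cornerInv_eq (s := e * s * e) (t := s) ?_ rfl, mul_assoc]
  rw [mul_assoc, h.pt.inv_eq_of_mem_corner]

end Consequences

/-! ### Assembly of the structure theorem -/

open SemigroupKernel in
theorem proposition2p15 {k : Type u} [Field k] [IsAlgClosed k]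
    (S : Over (Spec (CommRingCat.of k))) [IsVariety S] [SemigroupObj S]
    (e : Pt S) (he : IsMinimalIdempotent e) :
    -- the subsets involved are closed, and `eSe` is a closed algebraic group with neutral element `e`
    IsClosed (corner e) ∧ IsClosed (leftFiber e) ∧ IsClosed (rightFiber e) ∧
    (∀ g ∈ corner e, IsCornerInv e g (cornerInv e g)) ∧
    ∃ _ : GrpObj (cornerVar e),
      Pt.map (closedSubvariety.incl (corner e)) MonObj.one = e ∧
      (∀ g h : Pt (cornerVar e), (g * h).incl = g.incl * h.incl) ∧
    -- (i) `s ↦ s (ese)⁻¹ s` is a retraction of varieties of `S` to the closed ideal `SeS`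
    IsClosed (twoSided e : Set (Pt S)) ∧ IsTwoSidedIdeal (twoSided e : Set (Pt S)) ∧
    (∃ ρ : S ⟶ twoSidedVar e,
      closedSubvariety.incl (twoSided e : Set (Pt S)) ≫ ρ = 𝟙 (twoSidedVar e) ∧
      ∀ s : Pt S, (Pt.map ρ s).incl = s * cornerInv e (e * s * e) * s) ∧
    -- (ii) `Φ : (x, g, y) ↦ x g y` is an isomorphism of varieties to `SeS`
    (∃ Φ : leftVar e ⊗ (cornerVar e ⊗ rightVar e) ≅ twoSidedVar e,
      (∀ (x : Pt (leftVar e)) (g : Pt (cornerVar e)) (y : Pt (rightVar e)),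
        (Pt.map Φ.hom (x.pair (g.pair y))).incl = x.incl * g.incl * y.incl) ∧
      -- (iii) through `Φ`, the semigroup law of `SeS` becomes
      -- `(x, g, y) (x', g', y') = (x, g π(y, x') g', y')`, where `π (y, z) = y z`
      (∃ (π : rightVar e ⊗ leftVar e ⟶ cornerVar e)
          (_ : SemigroupObj (twoSidedVar e))
          (_ : SemigroupObj (leftVar e ⊗ (cornerVar e ⊗ rightVar e))),
        (∀ (y : Pt (rightVar e)) (z : Pt (leftVar e)),
          (Pt.map π (y.pair z)).incl = y.incl * z.incl) ∧
        (∀ a b : Pt (twoSidedVar e), (a * b).incl = a.incl * b.incl) ∧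
        (∀ (x x' : Pt (leftVar e)) (g g' : Pt (cornerVar e)) (y y' : Pt (rightVar e)),
          x.pair (g.pair y) * x'.pair (g'.pair y')
            = x.pair ((g * Pt.map π (y.pair x') * g').pair y')) ∧
        (∀ a b : Pt (leftVar e ⊗ (cornerVar e ⊗ rightVar e)),
          Pt.map Φ.hom (a * b) = Pt.map Φ.hom a * Pt.map Φ.hom b) ∧
        -- the idempotents of `SeS` are the triples `(x, π(y, x)⁻¹, y)`
        (∀ (x : Pt (leftVar e)) (g : Pt (cornerVar e)) (y : Pt (rightVar e)),
          IsIdempotentElem (Pt.map Φ.hom (x.pair (g.pair y))) ↔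
            g = Pt.map GrpObj.inv (Pt.map π (y.pair x))))) ∧
    -- `(x, y) ↦ x (y x)⁻¹ y` is an isomorphism of varieties from `ₑSe × eSₑ` to `E(SeS)`
    IsClosed (idempotents e) ∧
    (∃ Ψ : leftVar e ⊗ rightVar e ≅ idempotentVar e,
      ∀ (x : Pt (leftVar e)) (y : Pt (rightVar e)),
        (Pt.map Ψ.hom (x.pair y)).incl = x.incl * cornerInv e (y.incl * x.incl) * y.incl) ∧
    -- (iv) the semigroup `SeS` has no proper two-sided ideal
    (∀ I : Set (twoSided e), IsTwoSidedIdeal I → I = Set.univ) ∧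
    -- (v) `SeS` is the smallest two-sided ideal of `S`, and does not depend on `e`
    IsLeast {I : Set (Pt S) | IsTwoSidedIdeal I} (twoSided e : Set (Pt S)) ∧
    (∀ f : Pt S, IsMinimalIdempotent f → twoSided f = twoSided e) ∧
    -- (vi) the minimal idempotents of `S` are exactly the idempotents of `SeS`
    (∀ f : Pt S, IsMinimalIdempotent f ↔ f ∈ twoSided e ∧ IsIdempotentElem f) := by
  obtain ⟨j, hj⟩ := he.exists_isCornerInversion
  obtain ⟨grp, ι, h, hone, hmul, hinv⟩ := exists_grpObj_corner hj
  have hp := h.pt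
  obtain ⟨qG, hG⟩ := h.exists_isRetract_corner
  obtain ⟨qL, hL⟩ := h.exists_isRetract_left
  obtain ⟨qR, hR⟩ := h.exists_isRetract_right
  obtain ⟨qK, hK⟩ := h.exists_isRetract_twoSided
  obtain ⟨qE, hE⟩ := h.exists_isRetract_idempotents
  have hmul' : ∀ g h : Pt (cornerVar e), (g * h).incl = g.incl * h.incl :=
    Pt.map_mul_of_restricts _ hmul
  refine ⟨hG.isClosed, hL.isClosed, hR.isClosed, ?_, grp, hone, hmul', hK.isClosed,
    hp.isTwoSidedIdeal, h.exists_retraction_twoSided, ?_, hE.isClosed, ?_, hp.ideal_eq_univ,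
    hp.isLeast, ?_, hp.isMinimalIdempotent_iff fun f hf => hf.exists_isCornerInversion⟩
  · rintro g ⟨s, rfl⟩
    have hex : ∃ t, IsCornerInv e (e * s * e) t := ⟨_, hp.isCornerInv s⟩
    rw [cornerInv, dif_pos hex]
    exact hex.choose_spec
  · obtain ⟨Φ, hΦ⟩ := h.exists_tripleIso
    obtain ⟨π, hπ⟩ := h.exists_pairing
    obtain ⟨m, hm⟩ := h.exists_twoSided_mul
    have hΦ' : ∀ (x : Pt (leftVar e)) (g : Pt (cornerVar e)) (y : Pt (rightVar e)),
        (Pt.map Φ.hom (x.pair (g.pair y))).incl = x.incl * (g.incl * y.incl) := fun x g y => by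
      rw [Pt.incl, ← Pt.map_comp, hΦ]
      simp only [Pt.map_mul, Pt.map_comp, Pt.map_fst_pair, Pt.map_snd_pair, Pt.incl]
    have hπ' : ∀ (y : Pt (rightVar e)) (z : Pt (leftVar e)),
        (Pt.map π (y.pair z)).incl = y.incl * z.incl := fun y z => by
      rw [Pt.incl, ← Pt.map_comp, hπ]
      simp only [Pt.map_mul, Pt.map_comp, Pt.map_fst_pair, Pt.map_snd_pair, Pt.incl]
    refine ⟨Φ, fun x g y => (hΦ' x g y).trans (mul_assoc _ _ _).symm, π,
      SemigroupObj.restrict _ m hm, ?_⟩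
    let _ : SemigroupObj (twoSidedVar e) := SemigroupObj.restrict _ m hm
    have hK' : ∀ a b : Pt (twoSidedVar e), (a * b).incl = a.incl * b.incl :=
      Pt.map_mul_of_restricts _ hm
    -- The law on triples is transported from $SeS$ through `Φ`; its explicit formula is then
    -- checked after the monomorphisms `Φ.hom` and the inclusion in $S$.
    let m' := (Φ.hom ⊗ₘ Φ.hom) ≫ m ≫ Φ.inv
    have hm' : m' ≫ Φ.hom = lift (fst _ _ ≫ Φ.hom) (snd _ _ ≫ Φ.hom) ≫ SemigroupObj.mul := by
      simp only [m', Category.assoc, Iso.inv_hom_id, Category.comp_id]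
      congr 1
    refine ⟨SemigroupObj.restrict Φ.hom m' hm', hπ', hK', ?_⟩
    let _ : SemigroupObj (leftVar e ⊗ (cornerVar e ⊗ rightVar e)) :=
      SemigroupObj.restrict Φ.hom m' hm'
    have hT : ∀ a b : Pt (leftVar e ⊗ (cornerVar e ⊗ rightVar e)),
        Pt.map Φ.hom (a * b) = Pt.map Φ.hom a * Pt.map Φ.hom b :=
      Pt.map_mul_of_restricts _ hm'
    refine ⟨fun x x' g g' y y' => ?_, hT, fun x g y => ?_⟩
    · apply (cancel_mono Φ.hom).1
      apply Pt.incl_injective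
      refine (congrArg Pt.incl (hT _ _)).trans ?_
      rw [hK', hΦ', hΦ']
      refine Eq.trans ?_ (hΦ' _ _ _).symm
      rw [hmul', hmul', hπ', IsCornerInversion.triple_mul]
      simp only [mul_assoc]
    · have hinv' : ∀ p, (Pt.map (GrpObj.inv (X := cornerVar e)) p).incl = Pt.map ι p.incl :=
        fun p => by rw [Pt.incl, ← Pt.map_comp, hinv, Pt.map_comp, Pt.incl]
      rw [← Pt.incl_injective.eq_iff (a := g), hinv', hπ',
        ← hp.triple_idem_iff (x.incl_mem hL.isClosed) (g.incl_mem hG.isClosed)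
          (y.incl_mem hR.isClosed), ← hΦ', IsIdempotentElem, IsIdempotentElem, ← hK',
        Pt.incl_injective.eq_iff]
  · obtain ⟨Ψ, hΨ⟩ := h.exists_idempotentIso
    refine ⟨Ψ, fun x y => ?_⟩
    rw [h.cornerInv_mul (x.incl_mem hL.isClosed) (y.incl_mem hR.isClosed), mul_assoc, Pt.incl,
      ← Pt.map_comp, hΨ]
    simp only [Pt.map_mul, Pt.map_comp, Pt.map_fst_pair, Pt.map_snd_pair, Pt.incl]
  · intro f hf
    obtain ⟨i, hi⟩ := hf.exists_isCornerInversion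
    exact hp.twoSided_eq hi
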